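/- Let $\Gamma$ be a countable discrete abelian group, $B$ a separable unital $C^*$-algebra and $\beta:\Gamma\to\mathrm{Aut}(B)$ an action (possibly trivial). Let $\Omega$ be a locally compact Hausdorff space on which $\Gamma$ acts by homeomorphisms and which contains $\Gamma$ as an open, discrete and dense subset, the action on $\Omega$ extending left translation on $\Gamma$. (Restriction to $\Gamma$ then identifies $A=C_0(\Omega,B)$ with a $C^*$-subalgebra of $\ell^\infty(\Gamma,B)$ that contains $C_0(\Gamma,B)$ and is invariant under $[\alpha_g(f)](x)=\beta_g(f(g^{-1}x))$.) Put $\partial\Omega=\Omega\setminus\Gamma$, and assume $\partial\Omega\neq\emptyset$ if $\Gamma$ is infinite. Let $\ell^2(\Gamma,B)$ be the right Hilbert $B$-module of all $\psi:\Gamma\to B$ for which $\sum_x\psi(x)^*\psi(x)$ converges in $B$, with $(\psi\mid\varphi)=\sum_x\psi(x)^*\varphi(x)$; let $\mathrm{End}_B(\ell^2(\Gamma,B))$ be its adjointable operators and $\mathbb K_B(\ell^2(\Gamma,B))$ the norm closure of the span of the operators $\Theta_{\chi,\eta}\psi=\chi\cdot(\eta\mid\psi)$. An operator $F\in\mathrm{End}_B(\ell^2(\Gamma,B))$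 is Fredholm if its class in $\mathrm{End}_B(\ell^2(\Gamma,B))/\mathbb K_B(\ell^2(\Gamma,B))$ is invertible. Represent $f\in C_0(\Omega,B)$ and $g\in\Gamma$ on $\ell^2(\Gamma,B)$ by $(f\psi)(x)=\beta_x^{-1}(f(x))\psi(x)$ and $(S_g\psi)(x)=\psi(g^{-1}x)$, so that $S_gf=\alpha_g(f)S_g$. For a $\Gamma$-invariant ideal $I$ of $A$, let $I\rtimes\Gamma\subset\mathrm{End}_B(\ell^2(\Gamma,B))$ be the norm closure of the finite sums $\sum_gS_gf_g$ with $f_g\in I$, and let $(A\rtimes\Gamma)^\sim=\mathbb C1+A\rtimes\Gamma$. For $\omega\in\partial\Omega$ let $\Xi_\omega=\overline{\{g^{-1}\cdot\omega\mid g\in\Gamma\}}$ be its quasi-orbit, and let $(\omega_j)_{j\in J}$ be a family of points with $\partial\Omega=\bigcup_{j\in J}\Xi_j$, $\Xi_j=\Xi_{\omega_j}$. With $A_j=\{f\in A: f|_{\Xi_j}=0\}$, let $$q_j:(A\rtimes\Gamma)^\sim\to(A\rtimes\Gamma)^\sim/(A_j\rtimes\Gamma)$$ be the quotient map. (The target is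 $C_0(\Xi_j,B)\rtimes\Gamma$ if $A$ is unital, and $C_0(\Xi_j,B)\rtimes\Gamma$ with a unit adjoined if $A$ is not unital.) If $F\in(C_0(\Omega,B)\rtimes\Gamma)^\sim$ and there is $\epsilon>0$ such that $\sigma(q_j(F))\cap(-\epsilon,\epsilon)=\emptyset$ for all $j\in J$, then $F$ is Fredholm on $\ell^2(\Gamma,B)$. -/

import Mathlib

open scoped ZeroAtInfty
open Set Filter Topology

noncomputable section

namespace CStarInterface

/-! ## The standard Hilbert C⋆-module `ℓ²(Γ, B)` -/

section HilbertModule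

variable {Γ B : Type*} [CStarAlgebra B]

/-- The Cauchy-Schwarz inequality for finite sums in a C⋆-algebra. -/
theorem norm_sum_star_mul_le (s : Finset Γ) (a b : Γ → B) :
    ‖∑ x ∈ s, star (a x) * b x‖ ≤
      √‖∑ x ∈ s, star (a x) * a x‖ * √‖∑ x ∈ s, star (b x) * b x‖ := by
  let _ := CStarAlgebra.spectralOrder B
  have := CStarAlgebra.spectralOrderedRing B
  let u : WithCStarModule B (s → B) := (WithCStarModule.equiv B (s → B)).symm fun x => star (b x)
  let v : WithCStarModule B (s → B) := (WithCStarModule.equiv B (s → B)).symm fun x => star (a x)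
  have h := CStarModule.norm_inner_le (A := B) (WithCStarModule B (s → B)) (x := u) (y := v)
  rw [WithCStarModule.pi_inner, WithCStarModule.pi_norm, WithCStarModule.pi_norm] at h
  simp only [WithCStarModule.inner_def, u, v, WithCStarModule.equiv_symm_pi_apply, star_star] at h
  rw [Finset.sum_coe_sort s (fun x => star (a x) * b x),
    Finset.sum_coe_sort s (fun x => star (a x) * a x),
    Finset.sum_coe_sort s (fun x => star (b x) * b x)] at h
  rwa [mul_comm] at h

theorem summable_star_mul {a b : Γ → B} (ha : Summable fun x => star (a x) * a x)
    (hb : Summable fun x => star (b x) * b x) : Summable fun x => star (a x) * b x := by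
  rw [summable_iff_vanishing_norm] at ha hb ⊢
  intro ε hε
  obtain ⟨s, hs⟩ := ha ε hε
  obtain ⟨t, ht⟩ := hb ε hε
  classical
  refine ⟨s ∪ t, fun r hr => ?_⟩
  rw [Finset.disjoint_union_right] at hr
  refine (norm_sum_star_mul_le r a b).trans_lt ?_
  have h1 := Real.sqrt_lt_sqrt (norm_nonneg _) (hs r hr.1)
  have h2 := Real.sqrt_lt_sqrt (norm_nonneg _) (ht r hr.2)
  calc _ < √ε * √ε := by
        exact mul_lt_mul'' h1 h2 (Real.sqrt_nonneg _) (Real.sqrt_nonneg _)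
    _ = ε := Real.mul_self_sqrt hε.le

variable (Γ B) in
/-- The functions `ψ : Γ → B` for which `∑ₓ ψ(x)⋆ ψ(x)` converges in `B`. -/
def l2Submodule : Submodule ℂ (Γ → B) where
  carrier := {ψ | Summable fun x => star (ψ x) * ψ x}
  zero_mem' := by simp
  add_mem' {a b} ha hb := by
    have h := (ha.add (summable_star_mul ha hb)).add ((summable_star_mul hb ha).add hb)
    refine h.congr fun x => ?_
    simp only [Pi.add_apply, star_add]
    noncomm_ring
  smul_mem' c a ha := by
    refine (Summable.const_smul (star c * c) ha).congr fun x => ?_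
    simp [smul_smul, mul_comm]

variable (Γ B) in
/-- The standard Hilbert C⋆-module `ℓ²(Γ, B)`. -/
def L2 : Type _ := l2Submodule Γ B

namespace L2

instance : AddCommGroup (L2 Γ B) := inferInstanceAs (AddCommGroup (l2Submodule Γ B))
instance : Module ℂ (L2 Γ B) := inferInstanceAs (Module ℂ (l2Submodule Γ B))
instance : CoeFun (L2 Γ B) (fun _ => Γ → B) := ⟨fun ψ => ψ.1⟩

@[ext] theorem ext {ψ φ : L2 Γ B} (h : ∀ x, ψ x = φ x) : ψ = φ := Subtype.ext (funext h)

@[simp] theorem add_apply (ψ φ : L2 Γ B) (x : Γ) : (ψ + φ) x = ψ x + φ x := rfl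
@[simp] theorem smul_apply (c : ℂ) (ψ : L2 Γ B) (x : Γ) : (c • ψ) x = c • ψ x := rfl
@[simp] theorem zero_apply (x : Γ) : (0 : L2 Γ B) x = 0 := rfl

theorem summable_self (ψ : L2 Γ B) : Summable fun x => star (ψ x) * ψ x := ψ.2

theorem summable_inner (ψ φ : L2 Γ B) : Summable fun x => star (ψ x) * φ x :=
  summable_star_mul ψ.2 φ.2

/-- The `B`-valued inner product `(ψ | φ) = ∑ₓ ψ(x)⋆ φ(x)`, linear in the second variable. -/
def inn (ψ φ : L2 Γ B) : B := ∑' x, star (ψ x) * φ x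

/-- The right action `(ψ · b)(x) = ψ(x) b` of `B`. -/
def rsmul (ψ : L2 Γ B) (b : B) : L2 Γ B :=
  ⟨fun x => ψ x * b, by
    refine ((ψ.summable_self.mul_left (star b)).mul_right b).congr fun x => ?_
    simp [mul_assoc]⟩

@[simp] theorem rsmul_apply (ψ : L2 Γ B) (b : B) (x : Γ) : rsmul ψ b x = ψ x * b := rfl

theorem inn_add_right (ψ φ χ : L2 Γ B) : inn ψ (φ + χ) = inn ψ φ + inn ψ χ := by
  simp only [inn, add_apply, mul_add]
  exact (summable_inner ψ φ).tsum_add (summable_inner ψ χ)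

theorem star_inn (ψ φ : L2 Γ B) : star (inn ψ φ) = inn φ ψ := by
  simp [inn, tsum_star]

theorem inn_add_left (ψ φ χ : L2 Γ B) : inn (ψ + φ) χ = inn ψ χ + inn φ χ := by
  rw [← star_inn, inn_add_right, star_add, star_inn, star_inn]

theorem inn_smul_right (c : ℂ) (ψ φ : L2 Γ B) : inn ψ (c • φ) = c • inn ψ φ := by
  simp only [inn, smul_apply, mul_smul_comm]
  exact (summable_inner ψ φ).tsum_const_smul c

theorem inn_smul_left (c : ℂ) (ψ φ : L2 Γ B) : inn (c • ψ) φ = star c • inn ψ φ := by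
  rw [← star_inn, inn_smul_right, star_smul, star_inn]

theorem inn_rsmul_right (ψ φ : L2 Γ B) (b : B) : inn ψ (rsmul φ b) = inn ψ φ * b := by
  simp only [inn, rsmul_apply, ← mul_assoc]
  exact (summable_inner ψ φ).tsum_mul_right b

theorem norm_inn_le (ψ φ : L2 Γ B) : ‖inn ψ φ‖ ≤ √‖inn ψ ψ‖ * √‖inn φ φ‖ := by
  have h1 := (summable_inner ψ φ).hasSum.norm
  have h2 := (summable_inner ψ ψ).hasSum.norm.sqrt
  have h3 := (summable_inner φ φ).hasSum.norm.sqrt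
  exact le_of_tendsto_of_tendsto' h1 (h2.mul h3) fun s => norm_sum_star_mul_le s ψ φ

/-- The Hilbert module norm `‖ψ‖ = ‖(ψ | ψ)‖^(1/2)`. -/
instance : Norm (L2 Γ B) := ⟨fun ψ => √‖inn ψ ψ‖⟩

theorem norm_def (ψ : L2 Γ B) : ‖ψ‖ = √‖inn ψ ψ‖ := rfl

theorem norm_sq (ψ : L2 Γ B) : ‖ψ‖ ^ 2 = ‖inn ψ ψ‖ := Real.sq_sqrt (norm_nonneg _)

theorem inn_self_eq_zero {ψ : L2 Γ B} (h : inn ψ ψ = 0) : ψ = 0 := by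
  let _ := CStarAlgebra.spectralOrder B
  have := CStarAlgebra.spectralOrderedRing B
  ext x
  have h1 : star (ψ x) * ψ x ≤ inn ψ ψ :=
    ψ.summable_self.le_tsum x fun y _ => star_mul_self_nonneg (ψ y)
  have h2 : star (ψ x) * ψ x = 0 := le_antisymm (h ▸ h1) (star_mul_self_nonneg _)
  simpa using (CStarRing.star_mul_self_eq_zero_iff (ψ x)).1 h2

theorem normedSpaceCore : NormedSpace.Core ℂ (L2 Γ B) where
  norm_nonneg ψ := Real.sqrt_nonneg _
  norm_smul c ψ := by
    rw [norm_def, norm_def, inn_smul_left, inn_smul_right, smul_smul, norm_smul,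
      Real.sqrt_mul (norm_nonneg _)]
    congr 1
    rw [norm_mul, norm_star, Real.sqrt_mul_self (norm_nonneg _)]
  norm_eq_zero_iff ψ := by
    constructor
    · intro h
      refine inn_self_eq_zero ?_
      rw [← norm_eq_zero, ← norm_sq, h]
      simp
    · rintro rfl
      simp [norm_def, inn]
  norm_triangle ψ φ := by
    have h0 : (0 : ℝ) ≤ ‖ψ‖ := Real.sqrt_nonneg _
    have h0' : (0 : ℝ) ≤ ‖φ‖ := Real.sqrt_nonneg _
    refine abs_le_of_sq_le_sq' ?_ (add_nonneg h0 h0') |>.2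
    rw [norm_sq, inn_add_left, inn_add_right, inn_add_right]
    have h1 := norm_inn_le ψ φ
    have h2 := norm_inn_le φ ψ
    rw [← norm_def, ← norm_def] at h1 h2
    calc _ ≤ (‖inn ψ ψ‖ + ‖inn ψ φ‖) + (‖inn φ ψ‖ + ‖inn φ φ‖) :=
          (norm_add_le _ _).trans (add_le_add (norm_add_le _ _) (norm_add_le _ _))
      _ ≤ (‖ψ‖ ^ 2 + ‖ψ‖ * ‖φ‖) + (‖φ‖ * ‖ψ‖ + ‖φ‖ ^ 2) := by
          rw [norm_sq, norm_sq]; gcongr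
      _ = _ := by ring

instance : NormedAddCommGroup (L2 Γ B) := NormedAddCommGroup.ofCore normedSpaceCore
instance : NormedSpace ℂ (L2 Γ B) := NormedSpace.ofCore normedSpaceCore

end L2

open L2

/-! ## Adjointable and compact operators, Fredholm operators -/

variable (Γ B) in
/-- The algebra `End_B(ℓ²(Γ, B))` of adjointable operators, with the operator norm. -/
def EndB : Subalgebra ℂ (L2 Γ B →L[ℂ] L2 Γ B) where
  carrier := {T | ∃ S : L2 Γ B →L[ℂ] L2 Γ B, ∀ ψ φ, inn (T ψ) φ = inn ψ (S φ)}
  mul_mem' := by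
    rintro T T' ⟨S, hS⟩ ⟨S', hS'⟩
    exact ⟨S' * S, fun ψ φ => by simp [hS, hS']⟩
  add_mem' := by
    rintro T T' ⟨S, hS⟩ ⟨S', hS'⟩
    exact ⟨S + S', fun ψ φ => by simp [hS, hS', inn_add_left, inn_add_right]⟩
  algebraMap_mem' c := ⟨star c • 1, fun ψ φ => by
    simp [Algebra.algebraMap_eq_smul_one, inn_smul_left, inn_smul_right]⟩

theorem norm_rsmul_le (χ : L2 Γ B) (b : B) : ‖rsmul χ b‖ ≤ ‖χ‖ * ‖b‖ := by
  refine abs_le_of_sq_le_sq' ?_ (by positivity) |>.2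
  rw [L2.norm_sq, inn_rsmul_right, ← star_inn, inn_rsmul_right, star_mul, star_inn,
    mul_pow, L2.norm_sq]
  calc _ ≤ ‖star b‖ * ‖inn χ χ‖ * ‖b‖ :=
        (norm_mul_le _ _).trans (by gcongr; exact norm_mul_le _ _)
    _ = _ := by rw [norm_star]; ring

@[reducible] instance : NormedRing (EndB Γ B) := SubringClass.toNormedRing _
instance : NormedAlgebra ℂ (EndB Γ B) := SubalgebraClass.toNormedAlgebra _

/-- The rank one operator `Θ_{χ,η}(ψ) = χ · (η | ψ)` as a bounded operator. -/
def thetaCLM (χ η : L2 Γ B) : L2 Γ B →L[ℂ] L2 Γ B :=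
  LinearMap.mkContinuous
    { toFun := fun ψ => rsmul χ (inn η ψ)
      map_add' := fun ψ φ => by ext x; simp [inn_add_right, mul_add]
      map_smul' := fun c ψ => by ext x; simp [inn_smul_right] }
    (‖χ‖ * ‖η‖) (by
      intro ψ
      calc _ ≤ ‖χ‖ * ‖inn η ψ‖ := norm_rsmul_le χ (inn η ψ)
        _ ≤ ‖χ‖ * (‖η‖ * ‖ψ‖) := by gcongr; exact norm_inn_le η ψ
        _ = _ := by ring)

@[simp] theorem thetaCLM_apply (χ η ψ : L2 Γ B) : thetaCLM χ η ψ = rsmul χ (inn η ψ) := rfl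

theorem inn_thetaCLM (χ η ψ φ : L2 Γ B) :
    inn (thetaCLM χ η ψ) φ = inn ψ (thetaCLM η χ φ) := by
  rw [thetaCLM_apply, thetaCLM_apply, ← star_inn, inn_rsmul_right, inn_rsmul_right, star_mul,
    star_inn, star_inn]

/-- The rank one operator `Θ_{χ,η}` as an adjointable operator. -/
def theta (χ η : L2 Γ B) : EndB Γ B := ⟨thetaCLM χ η, thetaCLM η χ, inn_thetaCLM χ η⟩

theorem inn_right_injective {u v : L2 Γ B} (h : ∀ ψ, inn ψ u = inn ψ v) : u = v := by
  have h1 : inn (u - v) (u - v) = 0 := by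
    have h2 := inn_add_right (u - v) (u - v) v
    rw [sub_add_cancel, h (u - v)] at h2
    exact right_eq_add.1 h2
  exact sub_eq_zero.1 (inn_self_eq_zero h1)

theorem endB_rsmul (T : EndB Γ B) (ψ : L2 Γ B) (b : B) :
    T.1 (rsmul ψ b) = rsmul (T.1 ψ) b := by
  obtain ⟨T, S, hS⟩ := T
  refine inn_right_injective fun φ => ?_
  change inn φ (T (rsmul ψ b)) = inn φ (rsmul (T ψ) b)
  rw [inn_rsmul_right, ← star_inn, hS, star_inn, inn_rsmul_right, ← star_inn, ← hS, star_inn]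

variable (Γ B) in
/-- The linear span of the rank one operators. -/
def finiteRank : Submodule ℂ (EndB Γ B) :=
  Submodule.span ℂ {T | ∃ χ η : L2 Γ B, T = theta χ η}

theorem mul_mem_finiteRank (T : EndB Γ B) {K : EndB Γ B} (hK : K ∈ finiteRank Γ B) :
    T * K ∈ finiteRank Γ B := by
  induction hK using Submodule.span_induction with
  | mem K h =>
    obtain ⟨χ, η, rfl⟩ := h
    refine Submodule.subset_span ⟨T.1 χ, η, ?_⟩
    ext1
    ext1 ψ
    exact endB_rsmul T χ (inn η ψ)
  | zero => simp
  | add K L _ _ hK hL => rw [mul_add]; exact add_mem hK hL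
  | smul c K _ hK => rw [mul_smul_comm]; exact Submodule.smul_mem _ c hK

theorem finiteRank_mul_mem (T : EndB Γ B) {K : EndB Γ B} (hK : K ∈ finiteRank Γ B) :
    K * T ∈ finiteRank Γ B := by
  induction hK using Submodule.span_induction with
  | mem K h =>
    obtain ⟨χ, η, rfl⟩ := h
    obtain ⟨T, S, hS⟩ := T
    refine Submodule.subset_span ⟨χ, S η, ?_⟩
    ext1
    ext1 ψ
    change rsmul χ (inn η (T ψ)) = rsmul χ (inn (S η) ψ)
    rw [← star_inn, hS, star_inn]
  | zero => simp
  | add K L _ _ hK hL => rw [add_mul]; exact add_mem hK hL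
  | smul c K _ hK => rw [smul_mul_assoc]; exact Submodule.smul_mem _ c hK

variable (Γ B) in
/-- The compact operators `𝕂_B(ℓ²(Γ, B))`: the norm closure of the span of the `Θ_{χ,η}`, a
(two-sided) ideal of `End_B(ℓ²(Γ, B))`. -/
def compactOperators : Ideal (EndB Γ B) where
  carrier := closure (finiteRank Γ B : Set (EndB Γ B))
  zero_mem' := subset_closure (zero_mem _)
  add_mem' ha hb := (finiteRank Γ B).topologicalClosure.add_mem ha hb
  smul_mem' T _ hK := map_mem_closure (continuous_const_mul T) hK
    fun _ h => mul_mem_finiteRank T h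

instance : (compactOperators Γ B).IsTwoSided where
  mul_mem_of_left T hK := map_mem_closure (f := fun K => K * T) (continuous_mul_const T) hK
    fun _ h => finiteRank_mul_mem T h

/-- `T` is Fredholm if its class in the generalised Calkin algebra
`End_B(ℓ²(Γ, B)) / 𝕂_B(ℓ²(Γ, B))` is invertible. -/
def IsFredholm (T : EndB Γ B) : Prop :=
  IsUnit (Ideal.Quotient.mk (compactOperators Γ B) T)

/-! ## Multiplication operators and shifts -/

/-- Pointwise multiplication by a bounded function, as a bounded operator. -/
def mulCLM (m : Γ → B) (C : ℝ) (hm : ∀ x, ‖m x‖ ≤ C) : L2 Γ B →L[ℂ] L2 Γ B :=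
  have hfin : ∀ (ψ : Γ → B) (t : Finset Γ), ‖∑ x ∈ t, star (m x * ψ x) * (m x * ψ x)‖ ≤
      C ^ 2 * ‖∑ x ∈ t, star (ψ x) * ψ x‖ := by
    intro ψ t
    let _ := CStarAlgebra.spectralOrder B
    have := CStarAlgebra.spectralOrderedRing B
    have h1 : ∑ x ∈ t, star (m x * ψ x) * (m x * ψ x) ≤
        (C ^ 2) • ∑ x ∈ t, star (ψ x) * ψ x := by
      rw [Finset.smul_sum]
      refine Finset.sum_le_sum fun x _ => ?_
      have h2 := CStarAlgebra.star_left_conjugate_le_norm_smul (a := ψ x)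
        (b := star (m x) * m x) (.star_mul_self _)
      rw [CStarRing.norm_star_mul_self] at h2
      have h3 : ‖m x‖ * ‖m x‖ ≤ C ^ 2 := by
        rw [sq]; exact mul_self_le_mul_self (norm_nonneg _) (hm x)
      calc _ = star (ψ x) * (star (m x) * m x) * ψ x := by rw [star_mul]; noncomm_ring
        _ ≤ _ := h2
        _ ≤ _ := smul_le_smul_of_nonneg_right h3 (star_mul_self_nonneg _)
    refine (CStarAlgebra.norm_le_norm_of_nonneg_of_le
      (Finset.sum_nonneg fun x _ => star_mul_self_nonneg _) h1).trans ?_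
    rw [norm_smul, Real.norm_of_nonneg (sq_nonneg C)]
  have hsum : ∀ ψ : L2 Γ B, Summable fun x => star (m x * ψ x) * (m x * ψ x) := by
    intro ψ
    have h := ψ.summable_self
    rw [summable_iff_vanishing_norm] at h ⊢
    intro ε hε
    obtain ⟨s, hs⟩ := h (ε / (C ^ 2 + 1)) (by positivity)
    refine ⟨s, fun t ht => (hfin ψ t).trans_lt ?_⟩
    have h4 := hs t ht
    rw [lt_div_iff₀ (by positivity)] at h4
    nlinarith [norm_nonneg (∑ x ∈ t, star (ψ x) * ψ x)]
  LinearMap.mkContinuous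
    { toFun := fun ψ => ⟨fun x => m x * ψ x, hsum ψ⟩
      map_add' := fun ψ φ => by ext x; exact mul_add (m x) (ψ x) (φ x)
      map_smul' := fun c ψ => by ext x; exact mul_smul_comm c (m x) (ψ x) }
    |C| (by
      intro ψ
      refine abs_le_of_sq_le_sq' ?_ (by positivity) |>.2
      rw [mul_pow, L2.norm_sq, L2.norm_sq, sq_abs]
      exact le_of_tendsto_of_tendsto' (hsum ψ).hasSum.norm
        (ψ.summable_self.hasSum.norm.const_mul (C ^ 2)) (hfin ψ))

/-- Pointwise multiplication `(m ψ)(x) = m(x) ψ(x)` by a bounded function `m : Γ → B`. -/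
def mulOp (m : Γ → B) (C : ℝ) (hm : ∀ x, ‖m x‖ ≤ C) : EndB Γ B :=
  ⟨mulCLM m C hm, mulCLM (fun x => star (m x)) C (fun x => by rw [norm_star]; exact hm x),
    fun ψ φ => tsum_congr fun x => by
      change star (m x * ψ x) * φ x = star (ψ x) * (star (m x) * φ x)
      rw [star_mul, mul_assoc]⟩

@[simp] theorem mulOp_apply (m : Γ → B) (C : ℝ) (hm : ∀ x, ‖m x‖ ≤ C) (ψ : L2 Γ B) (x : Γ) :
    (mulOp m C hm).1 ψ x = m x * ψ x := rfl

section Shift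

variable [Group Γ]

/-- The shift as a bounded operator. -/
def shiftCLM (g : Γ) : L2 Γ B →L[ℂ] L2 Γ B :=
  LinearMap.mkContinuous
    { toFun := fun ψ => ⟨fun x => ψ (g⁻¹ * x),
        ((Equiv.mulLeft g⁻¹).summable_iff (f := fun x => star (ψ x) * ψ x)).2 ψ.summable_self⟩
      map_add' := fun ψ φ => rfl
      map_smul' := fun c ψ => rfl }
    1 (by
      intro ψ
      rw [one_mul, norm_def, norm_def]
      exact (congrArg (fun b : B => √‖b‖)
        ((Equiv.mulLeft g⁻¹).tsum_eq fun x => star (ψ x) * ψ x)).le)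

/-- The shift `(S_g ψ)(x) = ψ(g⁻¹ x)`. -/
def shift (g : Γ) : EndB Γ B :=
  ⟨shiftCLM g, shiftCLM g⁻¹, fun ψ φ => by
    refine Eq.trans ?_ ((Equiv.mulLeft g⁻¹).tsum_eq fun x => star (ψ x) * shiftCLM g⁻¹ φ x)
    refine tsum_congr fun x => ?_
    change star (ψ (g⁻¹ * x)) * φ x = star (ψ (g⁻¹ * x)) * φ (g⁻¹⁻¹ * (g⁻¹ * x))
    rw [inv_inv, mul_inv_cancel_left]⟩

@[simp] theorem shift_apply (g : Γ) (ψ : L2 Γ B) (x : Γ) :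
    (shift g : EndB Γ B).1 ψ x = ψ (g⁻¹ * x) := rfl

theorem shift_mul (g h : Γ) : (shift g * shift h : EndB Γ B) = shift (g * h) := by
  ext1
  ext1 ψ
  ext x
  change ψ (h⁻¹ * (g⁻¹ * x)) = ψ ((g * h)⁻¹ * x)
  rw [mul_inv_rev, mul_assoc]

end Shift

end HilbertModule

/-! ## The space `Ω`, quasi-orbits and the crossed products -/

/-- A realisation of `Γ` inside a `Γ`-space `Ω` as an open, discrete and dense subset, such that the
action of `Γ` on `Ω` extends left translation; `Ω` is then a (partial) compactification of the
discrete space `Γ`. -/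
structure PartialCompactification (Γ Ω : Type*) [Group Γ] [TopologicalSpace Ω]
    [MulAction Γ Ω] where
  /-- The embedding of `Γ` in `Ω`. -/
  emb : Γ → Ω
  injective : Function.Injective emb
  isOpen_singleton : ∀ x, IsOpen {emb x}
  denseRange : DenseRange emb
  emb_mul : ∀ g x, emb (g * x) = g • emb x

/-- The boundary at infinity `∂Ω = Ω \ Γ`. -/
def PartialCompactification.boundary {Γ Ω : Type*} [Group Γ] [TopologicalSpace Ω]
    [MulAction Γ Ω] (ι : PartialCompactification Γ Ω) : Set Ω := (range ι.emb)ᶜ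

/-- The quasi-orbit of `ω`: the closure of `{g⁻¹ · ω | g ∈ Γ}`. (The boundary is closed in `Ω`, so
for `ω ∈ ∂Ω` it does not matter whether the closure is taken in `Ω` or in `∂Ω`.) -/
def quasiOrbit (Γ : Type*) {Ω : Type*} [Group Γ] [TopologicalSpace Ω] [MulAction Γ Ω] (ω : Ω) :
    Set Ω := closure (range fun g : Γ => g⁻¹ • ω)

section CrossedProduct

/- An action of the group `Γ` on `B` by automorphisms is a monoid homomorphism `β` from `Γ` to the
unital ⋆-endomorphisms of `B`; every `β g` is then invertible with inverse `β g⁻¹`. -/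
variable {Γ B Ω : Type*} [Group Γ] [CStarAlgebra B] [TopologicalSpace Ω] [MulAction Γ Ω]
  (β : Γ →* (B →⋆ₐ[ℂ] B)) (ι : PartialCompactification Γ Ω)

theorem norm_action_le (g : Γ) (b : B) : ‖β g b‖ ≤ ‖b‖ :=
  NonUnitalStarAlgHom.norm_apply_le (β g) b

/-- The faithful representation of `f ∈ C₀(Ω, B)` on `ℓ²(Γ, B)` by the multiplication operator
`(π(f) ψ)(x) = β_x⁻¹(f(x)) ψ(x)`, where `Γ ⊆ Ω`. If `β` is trivial, this is `(f ψ)(x) = f(x) ψ(x)`.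
Together with the shifts it is the regular representation: `S_g π(f) = π(α_g(f)) S_g`. -/
def rep (f : C₀(Ω, B)) : EndB Γ B :=
  mulOp (fun x => β x⁻¹ (f (ι.emb x))) ‖f.toBCF‖ fun x =>
    (norm_action_le β _ _).trans (f.toBCF.norm_coe_le_norm (ι.emb x))

@[simp] theorem rep_apply (f : C₀(Ω, B)) (ψ : L2 Γ B) (x : Γ) :
    (rep β ι f).1 ψ x = β x⁻¹ (f (ι.emb x)) * ψ x := rfl

theorem rep_mul (f k : C₀(Ω, B)) : rep β ι (f * k) = rep β ι f * rep β ι k := by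
  ext1
  ext1 ψ
  ext x
  change β x⁻¹ (f (ι.emb x) * k (ι.emb x)) * ψ x =
    β x⁻¹ (f (ι.emb x)) * (β x⁻¹ (k (ι.emb x)) * ψ x)
  rw [map_mul, mul_assoc]

variable [ContinuousConstSMul Γ Ω]

/-- The action `[α_g(f)](ω) = β_g(f(g⁻¹ · ω))` of `Γ` on `C₀(Ω, B)`. -/
def alpha (g : Γ) (f : C₀(Ω, B)) : C₀(Ω, B) where
  toFun ω := β g (f (g⁻¹ • ω))
  continuous_toFun := by
    have h : Continuous (β g) :=
      AddMonoidHomClass.continuous_of_bound (β g) 1 fun b => by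
        rw [one_mul]; exact norm_action_le β g b
    exact h.comp (f.continuous.comp (continuous_const_smul g⁻¹))
  zero_at_infty' := by
    have h1 : Tendsto (fun ω => f (g⁻¹ • ω)) (cocompact Ω) (𝓝 0) :=
      f.zero_at_infty'.comp (Homeomorph.smul g⁻¹).isClosedEmbedding.tendsto_cocompact
    refine squeeze_zero_norm (fun ω => norm_action_le β g _) ?_
    simpa using h1.norm

@[simp] theorem alpha_apply (g : Γ) (f : C₀(Ω, B)) (ω : Ω) :
    alpha β g f ω = β g (f (g⁻¹ • ω)) := rfl

theorem shift_mul_rep (g : Γ) (f : C₀(Ω, B)) :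
    shift g * rep β ι f = rep β ι (alpha β g f) * shift g := by
  ext1
  ext1 ψ
  ext x
  change β (g⁻¹ * x)⁻¹ (f (ι.emb (g⁻¹ * x))) * ψ (g⁻¹ * x) =
    β x⁻¹ (β g (f (g⁻¹ • ι.emb x))) * ψ (g⁻¹ * x)
  rw [ι.emb_mul, mul_inv_rev, inv_inv, map_mul]
  rfl

theorem rep_mul_shift (g : Γ) (f : C₀(Ω, B)) :
    rep β ι f * shift g = shift g * rep β ι (alpha β g⁻¹ f) := by
  rw [shift_mul_rep]
  congr 2
  ext ω
  simp only [alpha_apply, inv_inv, smul_inv_smul]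
  change f ω = (β g * β g⁻¹) (f ω)
  rw [← map_mul, mul_inv_cancel, map_one]
  rfl

/-- The finite sums `∑_g S_g f_g` with `f_g ∈ I`, for a linear subspace `I` of `C₀(Ω, B)`. -/
def crossedSpan (I : Set C₀(Ω, B)) : Submodule ℂ (EndB Γ B) :=
  Submodule.span ℂ {T | ∃ g : Γ, ∃ f ∈ I, T = shift g * rep β ι f}

/-- The crossed product `I ⋊ Γ ⊆ End_B(ℓ²(Γ, B))`, for a `Γ`-invariant ideal `I` of `C₀(Ω, B)`: the
norm closure of the finite sums `∑_g S_g f_g` with `f_g ∈ I`. -/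
def crossedProduct (I : Set C₀(Ω, B)) : Submodule ℂ (EndB Γ B) :=
  (crossedSpan β ι I).topologicalClosure

/-- The functions in `C₀(Ω, B)` that vanish on `Ξ`. -/
def vanishingOn (B : Type*) [CStarAlgebra B] (Ξ : Set Ω) : Set C₀(Ω, B) :=
  {f | ∀ ω ∈ Ξ, f ω = 0}

/-- `I` is invariant under the action `α` and under multiplication from both sides. -/
structure IsInvariantIdeal (I : Set C₀(Ω, B)) : Prop where
  alpha_mem : ∀ (g : Γ), ∀ f ∈ I, alpha β g f ∈ I
  mul_left : ∀ (k : C₀(Ω, B)), ∀ f ∈ I, k * f ∈ I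
  mul_right : ∀ (k : C₀(Ω, B)), ∀ f ∈ I, f * k ∈ I

theorem isInvariantIdeal_univ : IsInvariantIdeal β (univ : Set C₀(Ω, B)) :=
  ⟨fun _ _ _ => trivial, fun _ _ _ => trivial, fun _ _ _ => trivial⟩

theorem isInvariantIdeal_quasiOrbit (ω₀ : Ω) :
    IsInvariantIdeal β (vanishingOn B (quasiOrbit Γ ω₀)) where
  alpha_mem g f hf ω hω := by
    have h : g⁻¹ • ω ∈ quasiOrbit Γ ω₀ :=
      map_mem_closure (continuous_const_smul g⁻¹) hω (by
        rintro _ ⟨h, rfl⟩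
        exact ⟨h * g, by simp [mul_smul]⟩)
    rw [alpha_apply, hf _ h, map_zero]
  mul_left k f hf ω hω := by
    change k ω * f ω = 0
    rw [hf ω hω, mul_zero]
  mul_right k f hf ω hω := by
    change f ω * k ω = 0
    rw [hf ω hω, zero_mul]

variable {β} in
theorem mul_mem_crossedSpan {I : Set C₀(Ω, B)} (hI : IsInvariantIdeal β I) {T K : EndB Γ B}
    (hT : T ∈ crossedSpan β ι univ) (hK : K ∈ crossedSpan β ι I) : T * K ∈ crossedSpan β ι I := by
  induction hT using Submodule.span_induction with
  | mem T h =>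
    obtain ⟨g, f, -, rfl⟩ := h
    induction hK using Submodule.span_induction with
    | mem K h =>
      obtain ⟨h, k, hk, rfl⟩ := h
      refine Submodule.subset_span ⟨g * h, alpha β h⁻¹ f * k, hI.mul_left _ _ hk, ?_⟩
      rw [rep_mul, ← shift_mul, mul_assoc, ← mul_assoc (rep β ι f), rep_mul_shift]
      simp only [mul_assoc]
    | zero => simp
    | add K L _ _ hK hL => rw [mul_add]; exact add_mem hK hL
    | smul c K _ hK => rw [mul_smul_comm]; exact Submodule.smul_mem _ c hK
  | zero => simp
  | add K L _ _ hK hL => rw [add_mul]; exact add_mem hK hL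
  | smul c K _ hK => rw [smul_mul_assoc]; exact Submodule.smul_mem _ c hK

variable {β} in
theorem crossedSpan_mul_mem {I : Set C₀(Ω, B)} (hI : IsInvariantIdeal β I) {T K : EndB Γ B}
    (hT : T ∈ crossedSpan β ι univ) (hK : K ∈ crossedSpan β ι I) : K * T ∈ crossedSpan β ι I := by
  induction hT using Submodule.span_induction with
  | mem T h =>
    obtain ⟨g, f, -, rfl⟩ := h
    induction hK using Submodule.span_induction with
    | mem K h =>
      obtain ⟨h, k, hk, rfl⟩ := h
      refine Submodule.subset_span
        ⟨h * g, alpha β g⁻¹ k * f, hI.mul_right _ _ (hI.alpha_mem _ _ hk), ?_⟩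
      rw [rep_mul, ← shift_mul, mul_assoc, ← mul_assoc (rep β ι k), rep_mul_shift]
      simp only [mul_assoc]
    | zero => simp
    | add K L _ _ hK hL => rw [add_mul]; exact add_mem hK hL
    | smul c K _ hK => rw [smul_mul_assoc]; exact Submodule.smul_mem _ c hK
  | zero => simp
  | add K L _ _ hK hL => rw [mul_add]; exact add_mem hK hL
  | smul c K _ hK => rw [mul_smul_comm]; exact Submodule.smul_mem _ c hK

variable {β} in
theorem mul_mem_crossedProduct {I : Set C₀(Ω, B)} (hI : IsInvariantIdeal β I) {T K : EndB Γ B}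
    (hT : T ∈ crossedProduct β ι univ) (hK : K ∈ crossedProduct β ι I) :
    T * K ∈ crossedProduct β ι I :=
  map_mem_closure₂ continuous_mul hT hK fun _ h _ h' => mul_mem_crossedSpan ι hI h h'

variable {β} in
theorem crossedProduct_mul_mem {I : Set C₀(Ω, B)} (hI : IsInvariantIdeal β I) {T K : EndB Γ B}
    (hT : T ∈ crossedProduct β ι univ) (hK : K ∈ crossedProduct β ι I) :
    K * T ∈ crossedProduct β ι I :=
  map_mem_closure₂ continuous_mul hK hT fun _ h _ h' => crossedSpan_mul_mem ι hI h' h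

/-- The unitization `(C₀(Ω, B) ⋊ Γ)^∼ = ℂ 1 + C₀(Ω, B) ⋊ Γ ⊆ End_B(ℓ²(Γ, B))`. -/
def unitizedCrossedProduct : Subalgebra ℂ (EndB Γ B) where
  carrier := {T | ∃ z : ℂ, ∃ T₀ ∈ crossedProduct β ι univ, T = z • 1 + T₀}
  mul_mem' := by
    rintro _ _ ⟨z, T, hT, rfl⟩ ⟨w, S, hS, rfl⟩
    refine ⟨z * w, z • S + w • T + T * S, add_mem (add_mem (Submodule.smul_mem _ _ hS)
      (Submodule.smul_mem _ _ hT))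
      (mul_mem_crossedProduct ι (isInvariantIdeal_univ β) hT hS), ?_⟩
    rw [add_mul, mul_add, mul_add, smul_mul_smul_comm, one_mul, smul_mul_assoc, one_mul,
      mul_smul_comm, mul_one]
    abel
  add_mem' := by
    rintro _ _ ⟨z, T, hT, rfl⟩ ⟨w, S, hS, rfl⟩
    refine ⟨z + w, T + S, add_mem hT hS, ?_⟩
    rw [add_smul]
    abel
  algebraMap_mem' z := ⟨z, 0, zero_mem _, by rw [add_zero, Algebra.algebraMap_eq_smul_one]⟩

instance : Ring (unitizedCrossedProduct β ι) := Subalgebra.toRing _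
instance : Algebra ℂ (unitizedCrossedProduct β ι) := Subalgebra.algebra _

/-- For the ideal `A_ω ⊆ C₀(Ω, B)` of functions vanishing on the quasi-orbit `Ξ_ω`, the ideal
`A_ω ⋊ Γ` of `(C₀(Ω, B) ⋊ Γ)^∼`. -/
def bulkIdeal (ω : Ω) : Ideal (unitizedCrossedProduct β ι) where
  carrier := {T | (T : EndB Γ B) ∈ crossedProduct β ι (vanishingOn B (quasiOrbit Γ ω))}
  zero_mem' := zero_mem (crossedProduct β ι _)
  add_mem' ha hb := (crossedProduct β ι _).add_mem ha hb
  smul_mem' := by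
    rintro ⟨_, z, T, hT, rfl⟩ ⟨K, _⟩ hK
    change (z • 1 + T) * K ∈ crossedProduct β ι (vanishingOn B (quasiOrbit Γ ω))
    rw [add_mul, smul_mul_assoc, one_mul]
    exact add_mem (Submodule.smul_mem _ _ hK)
      (mul_mem_crossedProduct ι (isInvariantIdeal_quasiOrbit β ω) hT hK)

instance (ω : Ω) : (bulkIdeal β ι ω).IsTwoSided where
  mul_mem_of_left {K} T' hK := by
    revert hK
    obtain ⟨K, _⟩ := K
    obtain ⟨_, z, T, hT, rfl⟩ := T'
    intro hK
    change K * (z • 1 + T) ∈ crossedProduct β ι (vanishingOn B (quasiOrbit Γ ω))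
    rw [mul_add, mul_smul_comm, mul_one]
    exact add_mem (Submodule.smul_mem _ _ hK)
      (crossedProduct_mul_mem ι (isInvariantIdeal_quasiOrbit β ω) hT hK)

/-- The bulk algebra `(C₀(Ω, B) ⋊ Γ)^∼ / (A_ω ⋊ Γ)` of the quasi-orbit `Ξ_ω`. Because
`(C₀(Ω, B) ⋊ Γ) / (A_ω ⋊ Γ) = C₀(Ξ_ω, B) ⋊ Γ`, it is `C₀(Ξ_ω, B) ⋊ Γ` if `C₀(Ω, B)` is unital, and
`C₀(Ξ_ω, B) ⋊ Γ` with a unit adjoined if `C₀(Ω, B)` is not unital. -/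
def BulkAlgebra (ω : Ω) : Type _ := unitizedCrossedProduct β ι ⧸ bulkIdeal β ι ω

instance (ω : Ω) : Ring (BulkAlgebra β ι ω) := Ideal.Quotient.ring (bulkIdeal β ι ω)
instance (ω : Ω) : Algebra ℂ (BulkAlgebra β ι ω) := Ideal.Quotient.algebra ℂ

/-- The quotient map `q_ω : (C₀(Ω, B) ⋊ Γ)^∼ → (C₀(Ω, B) ⋊ Γ)^∼ / (A_ω ⋊ Γ)`. -/
def bulkMap (ω : Ω) : unitizedCrossedProduct β ι →ₐ[ℂ] BulkAlgebra β ι ω :=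
  Ideal.Quotient.mkₐ ℂ (bulkIdeal β ι ω)

end CrossedProduct
end CStarInterface
end

noncomputable section

namespace CStarInterface

section HilbertModuleTheory

variable {Γ B : Type*} [CStarAlgebra B]

namespace L2

@[simp] theorem sub_apply (ψ φ : L2 Γ B) (x : Γ) : (ψ - φ) x = ψ x - φ x := rfl

/-- Evaluation at a point is linear. -/
def evalₗ (x : Γ) : L2 Γ B →ₗ[ℂ] B where
  toFun ψ := ψ x
  map_add' _ _ := rfl
  map_smul' _ _ := rfl

@[simp] theorem sum_apply {ι : Type*} (s : Finset ι) (f : ι → L2 Γ B) (x : Γ) :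
    (∑ i ∈ s, f i) x = ∑ i ∈ s, f i x :=
  map_sum (evalₗ x) f s

open Classical in
/-- The restriction of a function to a finite set, extended by zero. -/
def ofFinset (s : Finset Γ) (a : Γ → B) : L2 Γ B :=
  ⟨fun x => if x ∈ s then a x else 0,
    summable_of_ne_finset_zero (s := s) fun x hx => by simp [hx]⟩

open Classical in
theorem ofFinset_apply (s : Finset Γ) (a : Γ → B) (x : Γ) :
    ofFinset s a x = if x ∈ s then a x else 0 := rfl

theorem inn_ofFinset_left (s : Finset Γ) (a : Γ → B) (ψ : L2 Γ B) :
    inn (ofFinset s a) ψ = ∑ x ∈ s, star (a x) * ψ x := by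
  rw [inn, tsum_eq_sum (s := s) fun x hx => by simp [ofFinset_apply, hx]]
  exact Finset.sum_congr rfl fun x hx => by simp [ofFinset_apply, hx]

theorem inn_ofFinset_self (s : Finset Γ) (a : Γ → B) :
    inn (ofFinset s a) (ofFinset s a) = ∑ x ∈ s, star (a x) * a x := by
  rw [inn_ofFinset_left]
  exact Finset.sum_congr rfl fun x hx => by simp [ofFinset_apply, hx]

theorem norm_ofFinset_sq (s : Finset Γ) (a : Γ → B) :
    ‖ofFinset s a‖ ^ 2 = ‖∑ x ∈ s, star (a x) * a x‖ := by
  rw [norm_sq, inn_ofFinset_self]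

theorem norm_ofFinset_le (s : Finset Γ) (ψ : L2 Γ B) : ‖ofFinset s ψ‖ ≤ ‖ψ‖ := by
  let _ := CStarAlgebra.spectralOrder B
  have := CStarAlgebra.spectralOrderedRing B
  refine abs_le_of_sq_le_sq' ?_ (norm_nonneg _) |>.2
  rw [norm_ofFinset_sq, norm_sq]
  exact CStarAlgebra.norm_le_norm_of_nonneg_of_le
    (Finset.sum_nonneg fun x _ => star_mul_self_nonneg _)
    (ψ.summable_self.sum_le_tsum s fun x _ => star_mul_self_nonneg _)

theorem norm_apply_le (ψ : L2 Γ B) (x : Γ) : ‖ψ x‖ ≤ ‖ψ‖ := by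
  have h := norm_ofFinset_le {x} ψ
  have h2 := norm_ofFinset_sq {x} ψ
  rw [Finset.sum_singleton, CStarRing.norm_star_mul_self, ← sq] at h2
  rwa [← (sq_eq_sq₀ (norm_nonneg _) (norm_nonneg _)).1 h2]

theorem norm_ofFinset_add_le (s : Finset Γ) (a b : Γ → B) :
    ‖ofFinset s (a + b)‖ ≤ ‖ofFinset s a‖ + ‖ofFinset s b‖ := by
  have h : ofFinset s (a + b) = ofFinset s a + ofFinset s b := by
    ext x
    by_cases hx : x ∈ s <;> simp [ofFinset_apply, hx]
  rw [h]
  exact norm_add_le _ _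

theorem tendsto_norm_ofFinset {ι : Type*} {l : Filter ι} (s : Finset Γ) {u : ι → Γ → B}
    {a : Γ → B} (h : ∀ x, Tendsto (fun i => u i x) l (𝓝 (a x))) :
    Tendsto (fun i => ‖ofFinset s (u i)‖) l (𝓝 ‖ofFinset s a‖) := by
  have h1 : ∀ c : Γ → B, ‖ofFinset s c‖ = √‖∑ x ∈ s, star (c x) * c x‖ := fun c => by
    rw [← norm_ofFinset_sq, Real.sqrt_sq (norm_nonneg _)]
  simp only [h1]
  exact (tendsto_finsetSum _ fun x _ => (h x).star.mul (h x)).norm.sqrt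

theorem norm_le_of_forall_ofFinset {ψ : L2 Γ B} {C : ℝ} (h : ∀ s, ‖ofFinset s ψ‖ ≤ C) :
    ‖ψ‖ ≤ C := by
  have hC : 0 ≤ C := (norm_nonneg _).trans (h ∅)
  refine abs_le_of_sq_le_sq' ?_ hC |>.2
  rw [norm_sq]
  refine le_of_tendsto' ψ.summable_self.hasSum.norm fun s => ?_
  rw [← norm_ofFinset_sq]
  exact pow_le_pow_left₀ (norm_nonneg _) (h s) 2

instance : CompleteSpace (L2 Γ B) := by
  refine Metric.complete_of_cauchySeq_tendsto fun u hu => ?_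
  have hpt : ∀ x, ∃ b, Tendsto (fun n => u n x) atTop (𝓝 b) := fun x => by
    refine cauchySeq_tendsto_of_complete (Metric.cauchySeq_iff.2 fun ε hε => ?_)
    obtain ⟨N, hN⟩ := Metric.cauchySeq_iff.1 hu ε hε
    refine ⟨N, fun m hm n hn => ?_⟩
    have := hN m hm n hn
    rw [dist_eq_norm] at this ⊢
    exact (norm_apply_le (u m - u n) x).trans_lt this
  choose a ha using hpt
  have key : ∀ ε > 0, ∃ N, ∀ n ≥ N, ∀ s, ‖ofFinset s (a - (u n).1)‖ ≤ ε := fun ε hε => by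
    obtain ⟨N, hN⟩ := Metric.cauchySeq_iff.1 hu ε hε
    refine ⟨N, fun n hn s => ?_⟩
    refine le_of_tendsto (tendsto_norm_ofFinset (l := atTop) s (u := fun m x => u m x - u n x)
      (a := a - (u n).1) fun x => (ha x).sub_const _) ?_
    filter_upwards [eventually_ge_atTop N] with m hm
    refine (norm_ofFinset_le s (u m - u n)).trans ?_
    rw [← dist_eq_norm]
    exact (hN m hm n hn).le
  have hsum : Summable fun x => star (a x) * a x := by
    rw [summable_iff_vanishing_norm]
    intro ε hε
    set δ := √ε / 4 with hδ
    have hδ0 : 0 < δ := by positivity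
    obtain ⟨N, hN⟩ := key δ hδ0
    obtain ⟨s, hs⟩ := summable_iff_vanishing_norm.1 (u N).summable_self (δ ^ 2) (by positivity)
    refine ⟨s, fun t ht => ?_⟩
    rw [← norm_ofFinset_sq]
    have h1 : ‖ofFinset t (u N)‖ ≤ δ := by
      refine abs_le_of_sq_le_sq' ?_ hδ0.le |>.2
      rw [norm_ofFinset_sq]
      exact (hs t ht).le
    have h2 := norm_ofFinset_add_le t (a - (u N).1) (u N)
    rw [sub_add_cancel] at h2
    have h3 : ‖ofFinset t a‖ ≤ 2 * δ := by linarith [hN N le_rfl t]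
    calc ‖ofFinset t a‖ ^ 2 ≤ (2 * δ) ^ 2 := pow_le_pow_left₀ (norm_nonneg _) h3 2
      _ = ε / 4 := by rw [hδ, mul_pow, div_pow, Real.sq_sqrt hε.le]; ring
      _ < ε := by linarith
  obtain ⟨ψ, rfl⟩ : ∃ ψ : L2 Γ B, ψ.1 = a := ⟨⟨a, hsum⟩, rfl⟩
  refine ⟨ψ, Metric.tendsto_atTop.2 fun ε hε => ?_⟩
  obtain ⟨N, hN⟩ := key (ε / 2) (by positivity)
  refine ⟨N, fun n hn => ?_⟩
  rw [dist_comm, dist_eq_norm]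
  exact (norm_le_of_forall_ofFinset (ψ := ψ - u n) fun s => hN n hn s).trans_lt (by linarith)

theorem tendsto_ofFinset (ψ : L2 Γ B) :
    Tendsto (fun s : Finset Γ => ofFinset s ψ) atTop (𝓝 ψ) := by
  classical
  refine Metric.tendsto_atTop.2 fun ε hε => ?_
  obtain ⟨s, hs⟩ := summable_iff_vanishing_norm.1 ψ.summable_self ((ε / 2) ^ 2) (by positivity)
  refine ⟨s, fun t ht => ?_⟩
  rw [dist_comm, dist_eq_norm]
  refine (norm_le_of_forall_ofFinset (C := ε / 2) fun r => ?_).trans_lt (by linarith)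
  have h : ofFinset r (ψ - ofFinset t ψ) = ofFinset (r \ t) ψ := by
    ext x
    by_cases hx : x ∈ r <;> by_cases hx' : x ∈ t <;> simp [ofFinset_apply, hx, hx']
  rw [h]
  refine abs_le_of_sq_le_sq' ?_ (by positivity) |>.2
  rw [norm_ofFinset_sq]
  exact (hs _ (Finset.disjoint_of_subset_right ht Finset.sdiff_disjoint)).le

/-- The inner product `(ψ | ·)` as a bounded linear map. -/
def innCLM (ψ : L2 Γ B) : L2 Γ B →L[ℂ] B :=
  LinearMap.mkContinuous
    { toFun := inn ψ
      map_add' := inn_add_right ψ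
      map_smul' := fun c φ => inn_smul_right c ψ φ }
    ‖ψ‖ (norm_inn_le ψ)

theorem continuous_inn_right (ψ : L2 Γ B) : Continuous (inn ψ) := (innCLM ψ).continuous

theorem continuous_inn_left (ψ : L2 Γ B) : Continuous fun φ => inn φ ψ := by
  simp_rw [← star_inn ψ]
  exact (continuous_inn_right ψ).star

theorem inn_sub_right (ψ φ χ : L2 Γ B) : inn ψ (φ - χ) = inn ψ φ - inn ψ χ :=
  map_sub (innCLM ψ) φ χ

/-- The basis vector at `y`. -/
def single (y : Γ) : L2 Γ B := ofFinset {y} fun _ => 1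

open Classical in
theorem single_apply (y x : Γ) : (single y : L2 Γ B) x = if x = y then 1 else 0 := by
  simp [single, ofFinset_apply]

theorem inn_single_left (y : Γ) (ψ : L2 Γ B) : inn (single y) ψ = ψ y := by
  simp [single, inn_ofFinset_left]

theorem ofFinset_eq_sum (s : Finset Γ) (a : Γ → B) :
    ofFinset s a = ∑ y ∈ s, rsmul (single y) (a y) := by
  classical
  ext x
  simp [single_apply, ofFinset_apply]

end L2

open L2

/-! ### `End_B(ℓ²(Γ, B))` is a C⋆-algebra -/

instance : Star (EndB Γ B) :=
  ⟨fun T => ⟨T.2.choose, T.1, fun ψ φ => by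
    rw [← star_inn, ← T.2.choose_spec, star_inn]⟩⟩

theorem inn_endB_left (T : EndB Γ B) (ψ φ : L2 Γ B) :
    inn (T.1 ψ) φ = inn ψ ((star T).1 φ) := T.2.choose_spec ψ φ

theorem endB_star_eq {T S : EndB Γ B} (h : ∀ ψ φ, inn (T.1 ψ) φ = inn ψ (S.1 φ)) :
    star T = S := by
  ext1
  ext1 φ
  exact inn_right_injective fun ψ => by rw [← inn_endB_left, h]

instance : StarRing (EndB Γ B) where
  star_involutive T := endB_star_eq fun ψ φ => by
    rw [← star_inn, ← inn_endB_left, star_inn]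
  star_mul T S := endB_star_eq fun ψ φ => by
    change inn (T.1 (S.1 ψ)) φ = inn ψ ((star S).1 ((star T).1 φ))
    rw [inn_endB_left, inn_endB_left]
  star_add T S := endB_star_eq fun ψ φ => by
    change inn (T.1 ψ + S.1 ψ) φ = inn ψ ((star T).1 φ + (star S).1 φ)
    rw [inn_add_left, inn_add_right, inn_endB_left, inn_endB_left]

instance : StarModule ℂ (EndB Γ B) where
  star_smul c T := endB_star_eq fun ψ φ => by
    change inn (c • T.1 ψ) φ = inn ψ (star c • (star T).1 φ)
    rw [inn_smul_left, inn_smul_right, inn_endB_left]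

instance : CStarRing (EndB Γ B) where
  norm_mul_self_le T := by
    have h : ‖T.1‖ ≤ √‖star T * T‖ := by
      refine ContinuousLinearMap.opNorm_le_bound _ (Real.sqrt_nonneg _) fun ψ => ?_
      refine abs_le_of_sq_le_sq' ?_ (by positivity) |>.2
      rw [L2.norm_sq, inn_endB_left, mul_pow, Real.sq_sqrt (norm_nonneg _)]
      refine (norm_inn_le _ _).trans ?_
      rw [← norm_def, ← norm_def]
      have h2 : ‖(star T).1 (T.1 ψ)‖ ≤ ‖star T * T‖ * ‖ψ‖ :=
        (star T * T).1.le_opNorm ψ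
      calc _ ≤ ‖ψ‖ * (‖star T * T‖ * ‖ψ‖) := by gcongr
        _ = _ := by ring
    calc ‖T.1‖ * ‖T.1‖ ≤ √‖star T * T‖ * √‖star T * T‖ := by gcongr
      _ = _ := Real.mul_self_sqrt (norm_nonneg _)

instance : CompleteSpace (EndB Γ B) := by
  refine Metric.complete_of_cauchySeq_tendsto fun u hu => ?_
  have hu' : CauchySeq fun n => star (u n) := by
    rw [Metric.cauchySeq_iff] at hu ⊢
    simpa only [dist_eq_norm, ← star_sub, norm_star] using hu
  have hval : ∀ v : ℕ → EndB Γ B, CauchySeq v → ∃ T : L2 Γ B →L[ℂ] L2 Γ B,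
      Tendsto (fun n => (v n).1) atTop (𝓝 T) := fun v hv =>
    cauchySeq_tendsto_of_complete (hv.map (uniformContinuous_subtype_val))
  obtain ⟨T, hT⟩ := hval u hu
  obtain ⟨S, hS⟩ := hval _ hu'
  have happ : ∀ {v : ℕ → L2 Γ B →L[ℂ] L2 Γ B} {R}, Tendsto v atTop (𝓝 R) →
      ∀ ψ, Tendsto (fun n => v n ψ) atTop (𝓝 (R ψ)) := fun h ψ =>
    ((ContinuousLinearMap.apply ℂ (L2 Γ B) ψ).continuous.tendsto _).comp h
  refine ⟨⟨T, S, fun ψ φ => ?_⟩, tendsto_subtype_rng.2 hT⟩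
  refine tendsto_nhds_unique (((continuous_inn_left φ).tendsto _).comp (happ hT ψ)) ?_
  refine (((continuous_inn_right ψ).tendsto _).comp (happ hS φ)).congr fun n => ?_
  exact (inn_endB_left (u n) ψ φ).symm

instance : CStarAlgebra (EndB Γ B) where

theorem endB_apply_apply (T : EndB Γ B) (ψ : L2 Γ B) (x : Γ) :
    T.1 ψ x = inn ((star T).1 (single x)) ψ := by
  rw [inn_endB_left, star_star, inn_single_left]

theorem star_endB_single_apply (T : EndB Γ B) (x y : Γ) :
    (star T).1 (single x) y = star (T.1 (single y) x) := by
  rw [← inn_single_left, ← inn_endB_left, ← star_inn, inn_single_left]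

/-- An adjointable operator is determined by its matrix. -/
theorem endB_ext {T S : EndB Γ B} (h : ∀ x y, T.1 (single y) x = S.1 (single y) x) : T = S := by
  ext1
  ext1 ψ
  ext x
  rw [endB_apply_apply, endB_apply_apply]
  congr 1
  ext y
  rw [star_endB_single_apply, star_endB_single_apply, h]

theorem endB_ofFinset_apply (T : EndB Γ B) (s : Finset Γ) (a : Γ → B) (x : Γ) :
    T.1 (ofFinset s a) x = ∑ y ∈ s, T.1 (single y) x * a y := by
  rw [ofFinset_eq_sum, map_sum, L2.sum_apply]
  exact Finset.sum_congr rfl fun y _ => by rw [endB_rsmul, rsmul_apply]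

theorem norm_endB_single_apply_le (T : EndB Γ B) (x y : Γ) : ‖T.1 (single y) x‖ ≤ ‖T‖ := by
  have h1 : ‖(single y : L2 Γ B)‖ ≤ 1 := by
    refine abs_le_of_sq_le_sq' ?_ zero_le_one |>.2
    rw [single, norm_ofFinset_sq]
    nontriviality B
    simp
  calc _ ≤ ‖T.1 (single y)‖ := norm_apply_le _ _
    _ ≤ ‖T‖ * ‖(single y : L2 Γ B)‖ := T.1.le_opNorm _
    _ ≤ ‖T‖ * 1 := by gcongr
    _ = _ := mul_one _

/-- The inequality `(Tψ | Tψ) ≤ ‖T‖² (ψ | ψ)` in `B`. -/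
theorem inn_endB_self_le [PartialOrder B] [StarOrderedRing B] (T : EndB Γ B) (ψ : L2 Γ B) :
    inn (T.1 ψ) (T.1 ψ) ≤ (‖T‖ ^ 2) • inn ψ ψ := by
  let _ := CStarAlgebra.spectralOrder (EndB Γ B)
  have := CStarAlgebra.spectralOrderedRing (EndB Γ B)
  have h1 := CStarAlgebra.star_mul_le_algebraMap_norm_sq (a := T)
  rw [← sub_nonneg] at h1
  obtain ⟨S, hS⟩ := CStarAlgebra.nonneg_iff_eq_star_mul_self.1 h1
  have h2 : inn (S.1 ψ) (S.1 ψ) = (‖T‖ ^ 2) • inn ψ ψ - inn (T.1 ψ) (T.1 ψ) := by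
    rw [inn_endB_left S, inn_endB_left T]
    have h3 : (star S).1 (S.1 ψ) = ((‖T‖ ^ 2 : ℝ) : ℂ) • ψ - (star T).1 (T.1 ψ) := by
      change (star S * S).1 ψ = _
      rw [← hS]
      rfl
    rw [h3, inn_sub_right, inn_smul_right]
    simp [← Complex.coe_smul]
  rw [← sub_nonneg, ← h2]
  exact tsum_nonneg fun x => star_mul_self_nonneg _

end HilbertModuleTheory

/-! ### Truncation of functions vanishing at infinity -/

section Truncation

variable {Ω B : Type*} [TopologicalSpace Ω] [CStarAlgebra B]

theorem isCompact_setOf_le_norm (f : C₀(Ω, B)) {ε : ℝ} (hε : 0 < ε) :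
    IsCompact {ω | ε ≤ ‖f ω‖} := by
  have h := f.zero_at_infty'.norm
  rw [norm_zero] at h
  obtain ⟨K, hK, hsub⟩ := mem_cocompact.1 (h (Iio_mem_nhds hε))
  refine hK.of_isClosed_subset (isClosed_le continuous_const f.continuous.norm) fun ω hω => ?_
  by_contra hn
  have h1 : ‖f ω‖ < ε := hsub hn
  exact h1.not_ge hω

/-- The function `f` pushed towards zero by `ε`. -/
def truncate (f : C₀(Ω, B)) (ε : ℝ) (hε : 0 < ε) : C₀(Ω, B) where
  toFun ω := (1 - ε / max ‖f ω‖ ε) • f ω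
  continuous_toFun := by
    have h1 : Continuous fun ω => max ‖f ω‖ ε := f.continuous.norm.max continuous_const
    exact (continuous_const.sub (continuous_const.div h1 fun ω =>
      (lt_max_of_lt_right hε).ne')).smul f.continuous
  zero_at_infty' := by
    have h := f.zero_at_infty'.norm
    rw [norm_zero] at h
    refine squeeze_zero_norm (fun ω => ?_) h
    rw [norm_smul]
    have h1 : 0 < max ‖f ω‖ ε := lt_max_of_lt_right hε
    have h2 : ε / max ‖f ω‖ ε ≤ 1 := (div_le_one h1).2 (le_max_right _ _)
    have h3 : 0 < ε / max ‖f ω‖ ε := by positivity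
    rw [Real.norm_of_nonneg (by linarith)]
    exact mul_le_of_le_one_left (norm_nonneg _) (by linarith)

theorem truncate_apply (f : C₀(Ω, B)) {ε : ℝ} (hε : 0 < ε) (ω : Ω) :
    truncate f ε hε ω = (1 - ε / max ‖f ω‖ ε) • f ω := rfl

theorem truncate_eq_zero (f : C₀(Ω, B)) {ε : ℝ} (hε : 0 < ε) {ω : Ω} (h : ‖f ω‖ ≤ ε) :
    truncate f ε hε ω = 0 := by
  rw [truncate_apply, max_eq_right h, div_self hε.ne', sub_self, zero_smul]

theorem norm_le_of_forall_apply {f : C₀(Ω, B)} {C : ℝ} (hC : 0 ≤ C) (h : ∀ ω, ‖f ω‖ ≤ C) :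
    ‖f‖ ≤ C := by
  rw [← ZeroAtInftyContinuousMap.norm_toBCF_eq_norm]
  exact (BoundedContinuousFunction.norm_le hC).2 h

theorem norm_sub_truncate_le (f : C₀(Ω, B)) {ε : ℝ} (hε : 0 < ε) :
    ‖f - truncate f ε hε‖ ≤ ε := by
  refine norm_le_of_forall_apply hε.le fun ω => ?_
  have h1 : 0 < max ‖f ω‖ ε := lt_max_of_lt_right hε
  have h2 : (f - truncate f ε hε) ω = (ε / max ‖f ω‖ ε) • f ω := by
    rw [ZeroAtInftyContinuousMap.sub_apply, truncate_apply, sub_smul, one_smul, sub_sub_cancel]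
  rw [h2, norm_smul, Real.norm_of_nonneg (by positivity), div_mul_eq_mul_div, div_le_iff₀ h1]
  gcongr
  exact le_max_left _ _

end Truncation

/-! ### Invertibility in closed subalgebras -/

theorem exists_left_inverse_one_sub {E : Type*} [CStarAlgebra E] {V : StarSubalgebra ℂ E}
    (hV : IsClosed (V : Set E)) {t : E} (ht : t ∈ V) (h : ‖t‖ < 1) : ∃ r ∈ V, r * (1 - t) = 1 := by
  refine ⟨∑' n : ℕ, t ^ n, ?_, geom_series_mul_neg t h⟩
  refine hV.mem_of_tendsto (summable_geometric_of_norm_lt_one h).hasSum (Eventually.of_forall ?_)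
  exact fun s => sum_mem fun n _ => pow_mem ht n

section Operators

variable {Γ B : Type*} [CStarAlgebra B]

theorem norm_mulOp_le (m : Γ → B) (C : ℝ) (hm : ∀ x, ‖m x‖ ≤ C) : ‖mulOp m C hm‖ ≤ |C| := by
  change ‖mulCLM m C hm‖ ≤ |C|
  unfold mulCLM
  exact LinearMap.mkContinuous_norm_le _ (abs_nonneg C) _

variable (Γ B) in
theorem isClosed_compactOperators : IsClosed (compactOperators Γ B : Set (EndB Γ B)) :=
  isClosed_closure

theorem theta_mem_compactOperators (χ η : L2 Γ B) : theta χ η ∈ compactOperators Γ B :=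
  subset_closure (Submodule.subset_span ⟨χ, η, rfl⟩)

theorem one_mem_compactOperators [Finite Γ] : (1 : EndB Γ B) ∈ compactOperators Γ B := by
  classical
  have := Fintype.ofFinite Γ
  have h : (1 : EndB Γ B) = ∑ y : Γ, theta (L2.single y) (L2.single y) := by
    refine endB_ext fun x z => ?_
    have h1 : (∑ y : Γ, theta (L2.single y) (L2.single y) : EndB Γ B).1 (L2.single z) =
        ∑ y : Γ, L2.rsmul (L2.single y) (L2.inn (L2.single y) (L2.single z : L2 Γ B)) := by
      rw [AddSubmonoidClass.coe_finsetSum, _root_.sum_apply]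
      rfl
    rw [h1, L2.sum_apply]
    simp only [L2.rsmul_apply, L2.inn_single_left, L2.single_apply]
    change (L2.single z : L2 Γ B) x = _
    simp [L2.single_apply]
  rw [h]
  exact sum_mem fun y _ => theta_mem_compactOperators _ _

end Operators

section CrossedProductTheory

variable {Γ B Ω : Type*} [Group Γ] [CStarAlgebra B] [TopologicalSpace Ω] [MulAction Γ Ω]
  {β : Γ →* (B →⋆ₐ[ℂ] B)} {ι : PartialCompactification Γ Ω}

theorem action_inv_apply (g : Γ) (b : B) : β g⁻¹ (β g b) = b := by
  change (β g⁻¹ * β g) b = b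
  rw [← map_mul, inv_mul_cancel, map_one]
  rfl

theorem norm_action (g : Γ) (b : B) : ‖β g b‖ = ‖b‖ := by
  refine le_antisymm (norm_action_le β g b) ?_
  conv_lhs => rw [← action_inv_apply (β := β) g b]
  exact norm_action_le β _ _

theorem norm_shift_le (g : Γ) : ‖(shift g : EndB Γ B)‖ ≤ 1 := by
  change ‖shiftCLM g‖ ≤ 1
  unfold shiftCLM
  exact LinearMap.mkContinuous_norm_le _ zero_le_one _

theorem norm_rep_le (f : C₀(Ω, B)) : ‖rep β ι f‖ ≤ ‖f‖ := by
  refine (norm_mulOp_le _ _ _).trans ?_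
  rw [abs_norm, ZeroAtInftyContinuousMap.norm_toBCF_eq_norm]

theorem rep_sub (f k : C₀(Ω, B)) : rep β ι (f - k) = rep β ι f - rep β ι k := by
  ext1
  ext1 ψ
  ext x
  change β x⁻¹ (f (ι.emb x) - k (ι.emb x)) * ψ x =
    β x⁻¹ (f (ι.emb x)) * ψ x - β x⁻¹ (k (ι.emb x)) * ψ x
  rw [map_sub, sub_mul]

theorem norm_shift_mul_rep_sub_le (g : Γ) (f k : C₀(Ω, B)) :
    ‖shift g * rep β ι f - shift g * rep β ι k‖ ≤ ‖f - k‖ := by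
  rw [← mul_sub, ← rep_sub]
  calc _ ≤ ‖(shift g : EndB Γ B)‖ * ‖rep β ι (f - k)‖ := norm_mul_le _ _
    _ ≤ 1 * ‖f - k‖ := by gcongr; exacts [norm_shift_le g, norm_rep_le _]
    _ = _ := one_mul _

theorem star_shift (g : Γ) : star (shift g : EndB Γ B) = shift g⁻¹ := by
  refine endB_star_eq fun ψ φ => ?_
  refine Eq.trans ?_ ((Equiv.mulLeft g⁻¹).tsum_eq fun x =>
    star (ψ x) * (shift g⁻¹ : EndB Γ B).1 φ x)
  refine tsum_congr fun x => ?_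
  change star (ψ (g⁻¹ * x)) * φ x = star (ψ (g⁻¹ * x)) * φ (g⁻¹⁻¹ * (g⁻¹ * x))
  rw [inv_inv, mul_inv_cancel_left]

theorem star_rep (f : C₀(Ω, B)) : star (rep β ι f) = rep β ι (star f) := by
  refine endB_star_eq fun ψ φ => tsum_congr fun x => ?_
  rw [rep_apply, rep_apply, star_mul, mul_assoc, ZeroAtInftyContinuousMap.star_apply, map_star]

theorem crossedSpan_le_crossedProduct (I : Set C₀(Ω, B)) :
    crossedSpan β ι I ≤ crossedProduct β ι I := Submodule.le_topologicalClosure _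

theorem isClosed_crossedProduct (I : Set C₀(Ω, B)) :
    IsClosed (crossedProduct β ι I : Set (EndB Γ B)) := Submodule.isClosed_topologicalClosure _

theorem crossedProduct_mono {I I' : Set C₀(Ω, B)} (h : I ⊆ I') :
    crossedProduct β ι I ≤ crossedProduct β ι I' :=
  Submodule.topologicalClosure_mono (Submodule.span_mono fun _ ⟨g, f, hf, e⟩ => ⟨g, f, h hf, e⟩)

theorem crossedProduct_le {I : Set C₀(Ω, B)} {S : Submodule ℂ (EndB Γ B)}
    (hS : IsClosed (S : Set (EndB Γ B))) (h : ∀ g, ∀ f ∈ I, shift g * rep β ι f ∈ S) :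
    crossedProduct β ι I ≤ S :=
  Submodule.topologicalClosure_minimal _ (Submodule.span_le.2 fun _ ⟨g, f, hf, e⟩ => e ▸ h g f hf)
    hS

theorem vanishingOn_anti {Y Z : Set Ω} (h : Y ⊆ Z) : vanishingOn B Z ⊆ vanishingOn B Y :=
  fun _ hf ω hω => hf ω (h hω)

theorem star_mem_vanishingOn {Y : Set Ω} {f : C₀(Ω, B)} (hf : f ∈ vanishingOn B Y) :
    star f ∈ vanishingOn B Y := fun ω hω => by
  rw [ZeroAtInftyContinuousMap.star_apply, hf ω hω, star_zero]

theorem mem_quasiOrbit_self (ω : Ω) : ω ∈ quasiOrbit Γ ω := subset_closure ⟨1, by simp⟩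

theorem quasiOrbit_subset {Y : Set Ω} (hY : ∀ (g : Γ), ∀ y ∈ Y, g • y ∈ Y) (hc : IsClosed Y)
    {ω : Ω} (h : ω ∈ Y) : quasiOrbit Γ ω ⊆ Y :=
  closure_minimal (by rintro _ ⟨g, rfl⟩; exact hY _ _ h) hc

/-- An element of the ideal of an intersection of a chain of closed sets is approximated by
elements of the ideals of the members of the chain. -/
theorem exists_near_mem_of_chain {S : Set (Set Ω)} (hne : S.Nonempty) (hS : IsChain (· ⊆ ·) S)
    (hc : ∀ Z ∈ S, IsClosed Z) {T : EndB Γ B} (hT : T ∈ crossedProduct β ι (vanishingOn B (⋂₀ S)))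
    {ε : ℝ} (hε : 0 < ε) :
    ∃ Z ∈ S, ∃ K ∈ crossedProduct β ι (vanishingOn B Z), ‖T - K‖ < ε := by
  suffices h : ∀ T ∈ crossedSpan β ι (vanishingOn B (⋂₀ S)), ∀ ε > 0,
      ∃ Z ∈ S, ∃ K ∈ crossedProduct β ι (vanishingOn B Z), ‖T - K‖ < ε by
    obtain ⟨T', hT', hd⟩ := Metric.mem_closure_iff.1 hT (ε / 2) (by positivity)
    obtain ⟨Z, hZ, K, hK, hd'⟩ := h T' hT' (ε / 2) (by positivity)
    refine ⟨Z, hZ, K, hK, ?_⟩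
    rw [dist_eq_norm] at hd
    calc ‖T - K‖ = ‖(T - T') + (T' - K)‖ := by rw [sub_add_sub_cancel]
      _ ≤ _ := norm_add_le _ _
      _ < ε := by linarith
  intro T hT
  induction hT using Submodule.span_induction with
  | mem T h =>
    obtain ⟨g, f, hf, rfl⟩ := h
    intro ε hε
    have : Nonempty S := hne.to_subtype
    have hdir : Directed (· ⊇ ·) (fun Z : S => (Z : Set Ω)) := fun Y Z => by
      rcases hS.total Y.2 Z.2 with h | h
      · exact ⟨Y, subset_rfl, h⟩
      · exact ⟨Z, h, subset_rfl⟩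
    obtain ⟨⟨Z, hZ⟩, hdisj⟩ := (isCompact_setOf_le_norm f (half_pos hε)).elim_directed_family_closed
      (fun Z : S => (Z : Set Ω)) (fun Z => hc Z Z.2) (by
        rw [← sInter_eq_iInter]
        refine eq_empty_of_forall_notMem fun ω hω => ?_
        have h1 : ε / 2 ≤ ‖f ω‖ := hω.1
        rw [hf ω hω.2, norm_zero] at h1
        linarith) hdir
    refine ⟨Z, hZ, shift g * rep β ι (truncate f (ε / 2) (half_pos hε)),
      crossedSpan_le_crossedProduct _ (Submodule.subset_span ⟨g, _, fun ω hω => ?_, rfl⟩), ?_⟩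
    · refine truncate_eq_zero f _ ?_
      by_contra hn
      exact (hdisj ▸ ⟨(not_le.1 hn).le, hω⟩ : ω ∈ (∅ : Set Ω))
    · exact ((norm_shift_mul_rep_sub_le _ _ _).trans (norm_sub_truncate_le f _)).trans_lt
        (by linarith)
  | zero =>
    intro ε hε
    obtain ⟨Z, hZ⟩ := hne
    exact ⟨Z, hZ, 0, zero_mem _, by simpa using hε⟩
  | add T R _ _ hT hR =>
    intro ε hε
    obtain ⟨Y, hY, K, hK, h1⟩ := hT (ε / 2) (by positivity)
    obtain ⟨Z, hZ, L, hL, h2⟩ := hR (ε / 2) (by positivity)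
    have h3 : ‖T + R - (K + L)‖ < ε := by
      rw [add_sub_add_comm]
      exact (norm_add_le _ _).trans_lt (by linarith)
    rcases hS.total hY hZ with h | h
    · exact ⟨Y, hY, K + L, add_mem hK (crossedProduct_mono (vanishingOn_anti h) hL), h3⟩
    · exact ⟨Z, hZ, K + L, add_mem (crossedProduct_mono (vanishingOn_anti h) hK) hL, h3⟩
  | smul c T _ hT =>
    intro ε hε
    obtain ⟨Z, hZ, K, hK, h⟩ := hT (ε / (‖c‖ + 1)) (by positivity)
    refine ⟨Z, hZ, c • K, Submodule.smul_mem _ _ hK, ?_⟩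
    rw [← smul_sub, norm_smul]
    rw [lt_div_iff₀ (by positivity)] at h
    nlinarith [norm_nonneg (T - K), norm_nonneg c]

/-! ### Compact operators -/

theorem rep_mem_compactOperators {f : C₀(Ω, B)} (hf : f ∈ vanishingOn B ι.boundary) :
    rep β ι f ∈ compactOperators Γ B := by
  classical
  rw [← SetLike.mem_coe, ← (isClosed_compactOperators Γ B).closure_eq]
  refine Metric.mem_closure_iff.2 fun ε hε => ?_
  have hfin : {x : Γ | ε / 2 ≤ ‖f (ι.emb x)‖}.Finite := by
    have h1 := (isCompact_setOf_le_norm f (half_pos hε)).elim_finite_subcover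
      (fun x : Γ => {ι.emb x}) ι.isOpen_singleton fun ω hω => by
        by_contra hn
        have h2 : ω ∈ ι.boundary := by
          rintro ⟨x, rfl⟩
          exact hn (mem_iUnion.2 ⟨x, rfl⟩)
        have h3 : ε / 2 ≤ ‖f ω‖ := hω
        rw [hf ω h2, norm_zero] at h3
        linarith
    obtain ⟨t, ht⟩ := h1
    refine t.finite_toSet.subset fun x hx => ?_
    obtain ⟨y, hy, hxy⟩ := mem_iUnion₂.1 (ht hx)
    rw [ι.injective hxy]
    exact hy
  refine ⟨∑ x ∈ hfin.toFinset,
    theta (L2.rsmul (L2.single x) (β x⁻¹ (f (ι.emb x)))) (L2.single x),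
    sum_mem fun x _ => theta_mem_compactOperators _ _, ?_⟩
  have h : rep β ι f - ∑ x ∈ hfin.toFinset,
      theta (L2.rsmul (L2.single x) (β x⁻¹ (f (ι.emb x)))) (L2.single x) =
      mulOp (fun x => if ε / 2 ≤ ‖f (ι.emb x)‖ then 0 else β x⁻¹ (f (ι.emb x))) (ε / 2)
        (fun x => by
          split_ifs with h
          · simpa using (half_pos hε).le
          · exact (norm_action_le β _ _).trans (not_le.1 h).le) := by
    ext1
    ext1 ψ
    ext x
    have h1 : (∑ x ∈ hfin.toFinset,
        theta (L2.rsmul (L2.single x) (β x⁻¹ (f (ι.emb x)))) (L2.single x) : EndB Γ B).1 ψ =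
        ∑ y ∈ hfin.toFinset, L2.rsmul (L2.rsmul (L2.single y) (β y⁻¹ (f (ι.emb y))))
          (L2.inn (L2.single y) ψ) := by
      rw [AddSubmonoidClass.coe_finsetSum, _root_.sum_apply]
      rfl
    change (rep β ι f).1 ψ x - (_ : EndB Γ B).1 ψ x = _
    rw [h1, L2.sum_apply, mulOp_apply, rep_apply]
    simp only [L2.rsmul_apply, L2.inn_single_left, L2.single_apply]
    by_cases hx : ε / 2 ≤ ‖f (ι.emb x)‖ <;> simp [hx]
  rw [dist_eq_norm, h]
  refine (norm_mulOp_le _ _ _).trans_lt ?_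
  rw [abs_of_pos (half_pos hε)]
  linarith

theorem crossedProduct_boundary_le {T : EndB Γ B}
    (hT : T ∈ crossedProduct β ι (vanishingOn B ι.boundary)) : T ∈ compactOperators Γ B :=
  crossedProduct_le (S := (compactOperators Γ B).restrictScalars ℂ)
    (isClosed_compactOperators Γ B)
    (fun g _ hf => Ideal.mul_mem_left _ (shift g) (rep_mem_compactOperators hf)) hT

variable [ContinuousConstSMul Γ Ω]

theorem isInvariantIdeal_vanishingOn {Y : Set Ω} (hY : ∀ (g : Γ), ∀ y ∈ Y, g • y ∈ Y) :
    IsInvariantIdeal β (vanishingOn B Y) where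
  alpha_mem g f hf ω hω := by rw [alpha_apply, hf _ (hY _ _ hω), map_zero]
  mul_left k f hf ω hω := by
    change k ω * f ω = 0
    rw [hf ω hω, mul_zero]
  mul_right k f hf ω hω := by
    change f ω * k ω = 0
    rw [hf ω hω, zero_mul]

theorem smul_mem_quasiOrbit {ω₀ ω : Ω} (g : Γ) (h : ω ∈ quasiOrbit Γ ω₀) :
    g • ω ∈ quasiOrbit Γ ω₀ :=
  map_mem_closure (continuous_const_smul g) h (by
    rintro _ ⟨h, rfl⟩
    exact ⟨h * g⁻¹, by simp [mul_smul]⟩)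

theorem star_mem_crossedProduct {I : Set C₀(Ω, B)} (hI : IsInvariantIdeal β I)
    (hs : ∀ f ∈ I, star f ∈ I) {T : EndB Γ B} (hT : T ∈ crossedProduct β ι I) :
    star T ∈ crossedProduct β ι I := by
  refine map_mem_closure continuous_star hT fun T hT => ?_
  change T ∈ crossedSpan β ι I at hT
  change star T ∈ crossedSpan β ι I
  induction hT using Submodule.span_induction with
  | mem T h =>
    obtain ⟨g, f, hf, rfl⟩ := h
    refine Submodule.subset_span ⟨g⁻¹, alpha β g (star f), hI.alpha_mem _ _ (hs f hf), ?_⟩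
    rw [star_mul, star_shift, star_rep, rep_mul_shift, inv_inv]
  | zero => simp
  | add K L _ _ hK hL => rw [star_add]; exact add_mem hK hL
  | smul c K _ hK => rw [star_smul]; exact Submodule.smul_mem _ _ hK

variable (β ι) in
/-- The closure of the unitization of the crossed product, as a C⋆-subalgebra. -/
def unitizedClosure : StarSubalgebra ℂ (EndB Γ B) :=
  StarSubalgebra.topologicalClosure
    { unitizedCrossedProduct β ι with
      star_mem' := by
        rintro _ ⟨z, T, hT, rfl⟩
        refine ⟨star z, star T, star_mem_crossedProduct (isInvariantIdeal_univ β)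
          (fun _ _ => trivial) hT, ?_⟩
        rw [star_add, star_smul, star_one] }

theorem isClosed_unitizedClosure : IsClosed (unitizedClosure β ι : Set (EndB Γ B)) :=
  StarSubalgebra.isClosed_topologicalClosure _

theorem unitizedCrossedProduct_subset_closure {T : EndB Γ B}
    (hT : T ∈ unitizedCrossedProduct β ι) : T ∈ unitizedClosure β ι :=
  subset_closure hT

theorem crossedProduct_subset_closure {I : Set C₀(Ω, B)} {T : EndB Γ B}
    (hT : T ∈ crossedProduct β ι I) : T ∈ unitizedClosure β ι :=
  unitizedCrossedProduct_subset_closure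
    ⟨0, T, crossedProduct_mono (subset_univ I) hT, by rw [zero_smul, zero_add]⟩

theorem mul_mem_crossedProduct_of_closure {I : Set C₀(Ω, B)} (hI : IsInvariantIdeal β I)
    {T K : EndB Γ B} (hT : T ∈ unitizedClosure β ι) (hK : K ∈ crossedProduct β ι I) :
    T * K ∈ crossedProduct β ι I := by
  rw [← SetLike.mem_coe, ← (isClosed_crossedProduct I).closure_eq]
  refine map_mem_closure (f := fun T => T * K) (continuous_mul_const K) hT ?_
  rintro _ ⟨z, T, hT, rfl⟩
  change (z • 1 + T) * K ∈ crossedProduct β ι I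
  rw [add_mul, smul_mul_assoc, one_mul]
  exact add_mem (Submodule.smul_mem _ _ hK) (mul_mem_crossedProduct ι hI hT hK)

theorem crossedProduct_mul_mem_of_closure {I : Set C₀(Ω, B)} (hI : IsInvariantIdeal β I)
    {T K : EndB Γ B} (hT : T ∈ unitizedClosure β ι) (hK : K ∈ crossedProduct β ι I) :
    K * T ∈ crossedProduct β ι I := by
  rw [← SetLike.mem_coe, ← (isClosed_crossedProduct I).closure_eq]
  refine map_mem_closure (continuous_const_mul K) hT ?_
  rintro _ ⟨z, T, hT, rfl⟩
  rw [mul_add, mul_smul_comm, mul_one]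
  exact add_mem (Submodule.smul_mem _ _ hK) (crossedProduct_mul_mem ι hI hT hK)

theorem mul_mem_crossedSpan_union {Y Z : Set Ω} (hY : ∀ (g : Γ), ∀ y ∈ Y, g • y ∈ Y)
    {T K : EndB Γ B} (hT : T ∈ crossedSpan β ι (vanishingOn B Y))
    (hK : K ∈ crossedSpan β ι (vanishingOn B Z)) :
    T * K ∈ crossedSpan β ι (vanishingOn B (Y ∪ Z)) := by
  induction hT using Submodule.span_induction with
  | mem T h =>
    obtain ⟨g, f, hf, rfl⟩ := h
    induction hK using Submodule.span_induction with
    | mem K h =>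
      obtain ⟨h, k, hk, rfl⟩ := h
      refine Submodule.subset_span ⟨g * h, alpha β h⁻¹ f * k, ?_, ?_⟩
      · rintro ω (hω | hω)
        · have hI : IsInvariantIdeal β (vanishingOn B Y) := isInvariantIdeal_vanishingOn hY
          exact hI.mul_right _ _ (hI.alpha_mem _ _ hf) ω hω
        · change _ * k ω = 0
          rw [hk ω hω, mul_zero]
      · rw [rep_mul, ← shift_mul, mul_assoc, ← mul_assoc (rep β ι f), rep_mul_shift]
        simp only [mul_assoc]
    | zero => simp
    | add K L _ _ hK hL => rw [mul_add]; exact add_mem hK hL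
    | smul c K _ hK => rw [mul_smul_comm]; exact Submodule.smul_mem _ c hK
  | zero => simp
  | add K L _ _ hK hL => rw [add_mul]; exact add_mem hK hL
  | smul c K _ hK => rw [smul_mul_assoc]; exact Submodule.smul_mem _ c hK

theorem mul_mem_crossedProduct_union {Y Z : Set Ω} (hY : ∀ (g : Γ), ∀ y ∈ Y, g • y ∈ Y)
    {T K : EndB Γ B} (hT : T ∈ crossedProduct β ι (vanishingOn B Y))
    (hK : K ∈ crossedProduct β ι (vanishingOn B Z)) :
    T * K ∈ crossedProduct β ι (vanishingOn B (Y ∪ Z)) :=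
  map_mem_closure₂ continuous_mul hT hK fun _ h _ h' => mul_mem_crossedSpan_union hY h h'

end CrossedProductTheory

/-! ### Følner sets in commutative groups -/

section Folner

variable {Γ : Type*} [CommGroup Γ]

open Classical in
/-- The proportion of points of `E` that stay in `E` under translation by `g`. -/
def overlap (E : Finset Γ) (g : Γ) : ℝ := ((E.filter fun e => g * e ∈ E).card : ℝ) / E.card

theorem overlap_le_one (E : Finset Γ) (g : Γ) : overlap E g ≤ 1 := by
  classical
  refine div_le_one_of_le₀ ?_ (by positivity)
  exact_mod_cast Finset.card_filter_le _ _

/-- A finite subset of a commutative group has almost invariant finite sets. -/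
theorem exists_one_sub_le_overlap (S : Finset Γ) {ε : ℝ} (hε : 0 < ε) :
    ∃ E : Finset Γ, E.Nonempty ∧ ∀ g ∈ S, 1 - ε ≤ overlap E g := by
  classical
  let E : ℕ → Finset Γ := fun n =>
    (Fintype.piFinset fun _ : S => Finset.range (n + 1)).image fun k => ∏ g : S, (g : Γ) ^ k g
  have hmono : ∀ n, E n ⊆ E (n + 1) := fun n =>
    Finset.image_subset_image (Fintype.piFinset_subset _ _ fun _ =>
      Finset.range_subset_range.2 (by omega))
  have hone : ∀ n, (E n).Nonempty := fun n =>
    ⟨1, Finset.mem_image.2 ⟨0, by simp [Fintype.mem_piFinset], by simp⟩⟩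
  have hmul : ∀ n, ∀ g ∈ S, ∀ e ∈ E n, g * e ∈ E (n + 1) := by
    intro n g hg e he
    obtain ⟨k, hk, rfl⟩ := Finset.mem_image.1 he
    refine Finset.mem_image.2 ⟨k + Pi.single ⟨g, hg⟩ 1, ?_, ?_⟩
    · rw [Fintype.mem_piFinset] at hk ⊢
      intro a
      have h1 := Finset.mem_range.1 (hk a)
      have h2 : (Pi.single (⟨g, hg⟩ : S) 1 : S → ℕ) a ≤ 1 := by
        rw [Pi.single_apply]
        split_ifs <;> omega
      rw [Finset.mem_range, Pi.add_apply]
      omega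
    · simp only [Pi.add_apply, pow_add, Finset.prod_mul_distrib]
      rw [mul_comm, Finset.prod_eq_single (⟨g, hg⟩ : S)]
      · simp
      · intro b _ hb
        simp [hb]
      · simp
  have hcard : ∀ n, (E n).card ≤ (n + 1) ^ S.card := fun n => by
    refine Finset.card_image_le.trans ?_
    simp [Fintype.card_piFinset]
  obtain ⟨n, hn⟩ : ∃ n, ((E (n + 1)).card : ℝ) ≤ (1 + ε) * (E n).card := by
    by_contra! hcon
    have hgrow : ∀ n : ℕ, (1 + ε) ^ n ≤ ((E n).card : ℝ) := by
      intro n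
      induction n with
      | zero => simpa using (hone 0).card_pos
      | succ n ih =>
        rw [pow_succ']
        exact (mul_le_mul_of_nonneg_left ih (by positivity)).trans (hcon n).le
    have hlim := tendsto_pow_const_div_const_pow_of_one_lt S.card (r := 1 + ε) (by linarith)
    have hlim' := (hlim.comp (tendsto_add_atTop_nat 1)).eventually
      (Iio_mem_nhds (show (0 : ℝ) < 1 / (1 + ε) by positivity))
    obtain ⟨n, hn⟩ := hlim'.exists
    simp only [Function.comp_apply] at hn
    have h1 : (1 + ε) ^ n ≤ ((n + 1 : ℕ) : ℝ) ^ S.card :=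
      (hgrow n).trans (by exact_mod_cast hcard n)
    have h2 : ((n + 1 : ℕ) : ℝ) ^ S.card / (1 + ε) ^ (n + 1) < 1 / (1 + ε) := hn
    rw [div_lt_div_iff₀ (by positivity) (by positivity), one_mul, pow_succ] at h2
    nlinarith
  refine ⟨E n, hone n, fun g hg => ?_⟩
  have hpos : (0 : ℝ) < (E n).card := by exact_mod_cast (hone n).card_pos
  have h1 : ((E n).filter fun e => ¬ g * e ∈ E n).card ≤ (E (n + 1) \ E n).card := by
    refine Finset.card_le_card_of_injOn (fun e => g * e) (fun e he => ?_) fun a _ b _ h =>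
      mul_left_cancel h
    have he' := Finset.mem_filter.1 he
    exact Finset.mem_sdiff.2 ⟨hmul n g hg e he'.1, he'.2⟩
  have h2 := Finset.card_sdiff_add_card_eq_card (hmono n)
  have h3 := Finset.card_filter_add_card_filter_not (s := E n) fun e => g * e ∈ E n
  unfold overlap
  rw [le_div_iff₀ hpos]
  have h4 : ((E n).card : ℝ) ≤
      ((E n).filter fun e => g * e ∈ E n).card + ((E (n + 1)).card - (E n).card) := by
    have : (E n).card + (E n).card ≤
      ((E n).filter fun e => g * e ∈ E n).card + (E (n + 1)).card := by omega
    have : ((E n).card : ℝ) + (E n).card ≤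
      ((E n).filter fun e => g * e ∈ E n).card + (E (n + 1)).card := by exact_mod_cast this
    linarith
  linarith

end Folner

/-! ### Schur multipliers from finite sets -/

section Multiplier

variable {Γ B : Type*} [CommGroup Γ] [CStarAlgebra B]

open L2

/-- `S` is the Schur multiple of `T` by the positive definite function `overlap E`. -/
def IsMultiple (E : Finset Γ) (T S : EndB Γ B) : Prop :=
  ∀ z w, S.1 (single w) z = (overlap E (z * w⁻¹) : ℂ) • T.1 (single w) z

open Classical in
theorem card_filter_translates (E s : Finset Γ) {z w : Γ} (hw : w ∈ s) :
    ((Finset.image₂ (fun z e => z * e⁻¹) s E).filter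
      fun t => t⁻¹ * z ∈ E ∧ t⁻¹ * w ∈ E).card = (E.filter fun e => z * w⁻¹ * e ∈ E).card := by
  refine Finset.card_bij' (fun t _ => t⁻¹ * w) (fun e _ => w * e⁻¹) ?_ ?_ ?_ ?_
  · intro t ht
    obtain ⟨-, h1, h2⟩ := Finset.mem_filter.1 ht
    refine Finset.mem_filter.2 ⟨h2, ?_⟩
    convert h1 using 1
    rw [mul_comm t⁻¹ w, mul_assoc, inv_mul_cancel_left, mul_comm]
  · intro e he
    obtain ⟨h1, h2⟩ := Finset.mem_filter.1 he
    refine Finset.mem_filter.2 ⟨Finset.mem_image₂_of_mem hw h1, ?_, ?_⟩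
    · convert h2 using 1
      rw [mul_inv_rev, inv_inv, mul_comm (z * w⁻¹) e, mul_comm z, mul_assoc]
    · rwa [mul_inv_rev, inv_inv, inv_mul_cancel_right]
  · intro t _
    rw [mul_inv_rev, inv_inv, mul_inv_cancel_left]
  · intro e _
    rw [mul_inv_rev, inv_inv, inv_mul_cancel_right]

open Classical in
theorem sum_translates_smul (E s : Finset Γ) {M : Type*} [AddCommGroup M] [Module ℂ M]
    {z w : Γ} (hw : w ∈ s) (m : M) :
    (∑ t ∈ Finset.image₂ (fun z e => z * e⁻¹) s E,
      if t⁻¹ * z ∈ E then if t⁻¹ * w ∈ E then m else 0 else 0) =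
      ((E.card : ℂ) * (overlap E (z * w⁻¹) : ℂ)) • m := by
  simp_rw [← ite_and]
  rw [← Finset.sum_filter, Finset.sum_const, card_filter_translates E s hw, overlap]
  rcases E.eq_empty_or_nonempty with rfl | hE
  · simp
  · have h : (E.card : ℂ) ≠ 0 := by exact_mod_cast hE.card_pos.ne'
    push_cast
    rw [mul_div_cancel₀ _ h, Nat.cast_smul_eq_nsmul]

theorem norm_inn_multiple_le {E : Finset Γ} (hE : E.Nonempty) {T S : EndB Γ B}
    (h : IsMultiple E T S) (s : Finset Γ) (χ ψ : Γ → B) :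
    ‖inn (ofFinset s χ) (S.1 (ofFinset s ψ))‖ ≤ ‖T‖ * ‖ofFinset s χ‖ * ‖ofFinset s ψ‖ := by
  classical
  let _ := CStarAlgebra.spectralOrder B
  have := CStarAlgebra.spectralOrderedRing B
  have hn : (0 : ℝ) < E.card := by exact_mod_cast hE.card_pos
  have hone : overlap E 1 = 1 := by
    unfold overlap
    simp [hn.ne']
  let U := Finset.image₂ (fun z e : Γ => z * e⁻¹) s E
  let a : Γ → Γ → B := fun t z => if t⁻¹ * z ∈ E then χ z else 0
  let p : Γ → Γ → B := fun t z => if t⁻¹ * z ∈ E then ψ z else 0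
  let b : Γ → Γ → B := fun t z => T.1 (ofFinset s (p t)) z
  have hsq : ∀ θ : Γ → B, ∑ t ∈ U, ∑ z ∈ s,
      star (if t⁻¹ * z ∈ E then θ z else 0) * (if t⁻¹ * z ∈ E then θ z else 0) =
      (E.card : ℝ) • ∑ z ∈ s, star (θ z) * θ z := fun θ => by
    rw [Finset.sum_comm, Finset.smul_sum]
    refine Finset.sum_congr rfl fun z hz => ?_
    have h1 := sum_translates_smul E s (z := z) hz (star (θ z) * θ z)
    rw [mul_inv_cancel, hone, Complex.ofReal_one, mul_one] at h1
    refine Eq.trans (Finset.sum_congr rfl fun t _ => ?_) (h1.trans ?_)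
    · split_ifs <;> simp
    · rw [← Complex.coe_smul, Complex.ofReal_natCast]
  have hmain : (E.card : ℂ) • inn (ofFinset s χ) (S.1 (ofFinset s ψ)) =
      ∑ x ∈ U ×ˢ s, star (a x.1 x.2) * b x.1 x.2 := by
    rw [inn_ofFinset_left, Finset.sum_product, Finset.sum_comm, Finset.smul_sum]
    refine Finset.sum_congr rfl fun z _ => ?_
    simp only [b, endB_ofFinset_apply, Finset.mul_sum, Finset.smul_sum]
    rw [Finset.sum_comm]
    refine Finset.sum_congr rfl fun w hw => ?_
    refine Eq.trans ?_ ((sum_translates_smul E s (z := z) hw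
      (star (χ z) * (T.1 (single w) z * ψ w))).symm.trans (Finset.sum_congr rfl fun t _ => ?_))
    · rw [h z w, smul_mul_assoc, mul_smul_comm, smul_smul]
    · simp only [a, p]
      split_ifs <;> simp
  have hcs := norm_sum_star_mul_le (U ×ˢ s) (fun x => a x.1 x.2) (fun x => b x.1 x.2)
  rw [← hmain, norm_smul, Complex.norm_natCast] at hcs
  have ha : ‖∑ x ∈ U ×ˢ s, star (a x.1 x.2) * a x.1 x.2‖ = E.card * ‖ofFinset s χ‖ ^ 2 := by
    rw [Finset.sum_product, hsq χ, norm_smul, norm_ofFinset_sq, Real.norm_natCast]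
  have hb : ‖∑ x ∈ U ×ˢ s, star (b x.1 x.2) * b x.1 x.2‖ ≤
      ‖T‖ ^ 2 * (E.card * ‖ofFinset s ψ‖ ^ 2) := by
    have h1 : ∑ x ∈ U ×ˢ s, star (b x.1 x.2) * b x.1 x.2 ≤
        (‖T‖ ^ 2) • ((E.card : ℝ) • ∑ z ∈ s, star (ψ z) * ψ z) := by
      rw [← hsq ψ, Finset.sum_product, Finset.smul_sum]
      refine Finset.sum_le_sum fun t _ => ?_
      refine le_trans ?_ ((inn_endB_self_le T (ofFinset s (p t))).trans_eq ?_)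
      · exact (T.1 (ofFinset s (p t))).summable_self.sum_le_tsum s
          fun x _ => star_mul_self_nonneg _
      · rw [inn_ofFinset_self]
    refine (CStarAlgebra.norm_le_norm_of_nonneg_of_le
      (Finset.sum_nonneg fun x _ => star_mul_self_nonneg _) h1).trans ?_
    rw [norm_smul, norm_smul, norm_ofFinset_sq, Real.norm_natCast, Real.norm_of_nonneg (by positivity)]
  have hfin : E.card * ‖inn (ofFinset s χ) (S.1 (ofFinset s ψ))‖ ≤
      E.card * (‖T‖ * ‖ofFinset s χ‖ * ‖ofFinset s ψ‖) := by
    refine hcs.trans ?_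
    rw [ha]
    refine (mul_le_mul_of_nonneg_left (Real.sqrt_le_sqrt hb) (Real.sqrt_nonneg _)).trans_eq ?_
    rw [← Real.sqrt_mul (by positivity), Real.sqrt_eq_iff_mul_self_eq (by positivity) (by positivity)]
    ring
  exact le_of_mul_le_mul_left hfin hn

/-- Schur multiplication by `overlap E` is contractive. -/
theorem norm_multiple_le {E : Finset Γ} (hE : E.Nonempty) {T S : EndB Γ B}
    (h : IsMultiple E T S) : ‖S‖ ≤ ‖T‖ := by
  classical
  refine ContinuousLinearMap.opNorm_le_bound S.1 (norm_nonneg T) fun ψ => ?_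
  have hfin : ∀ s, ‖S.1 (ofFinset s ψ)‖ ≤ ‖T‖ * ‖ofFinset s ψ‖ := fun s => by
    refine norm_le_of_forall_ofFinset fun r => ?_
    have hext : ∀ (r' : Finset Γ) (θ : Γ → B), r' ⊆ r ∪ s →
        ofFinset (r ∪ s) (ofFinset r' θ).1 = ofFinset r' θ := fun r' θ hr' => by
      ext x
      by_cases hx : x ∈ r'
      · simp [ofFinset_apply, hx, Finset.mem_union.1 (hr' hx)]
      · simp [ofFinset_apply, hx]
    have h1 := norm_inn_multiple_le hE h (r ∪ s) (ofFinset r (S.1 (ofFinset s ψ))).1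
      (ofFinset s ψ).1
    rw [hext r _ Finset.subset_union_left, hext s _ Finset.subset_union_right,
      inn_ofFinset_left, ← norm_ofFinset_sq] at h1
    rcases (norm_nonneg (ofFinset r (S.1 (ofFinset s ψ)).1)).eq_or_lt with h0 | h0
    · rw [← h0]
      positivity
    · nlinarith
  refine le_of_tendsto_of_tendsto' ((S.1.continuous.tendsto _).comp (tendsto_ofFinset ψ)).norm
    ((tendsto_ofFinset ψ).norm.const_mul ‖T‖) hfin

theorem IsMultiple.sub {E : Finset Γ} {T S T' S' : EndB Γ B} (h : IsMultiple E T S)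
    (h' : IsMultiple E T' S') : IsMultiple E (T - T') (S - S') := fun z w => by
  change S.1 (single w) z - S'.1 (single w) z = _ • (T.1 (single w) z - T'.1 (single w) z)
  rw [h, h', smul_sub]

end Multiplier

/-! ### Fourier coefficients -/

section Fourier

open L2

section Group

variable {Γ B Ω : Type*} [Group Γ] [CStarAlgebra B] [TopologicalSpace Ω] [MulAction Γ Ω]
  {β : Γ →* (B →⋆ₐ[ℂ] B)} {ι : PartialCompactification Γ Ω}

open Classical in
theorem shift_mul_rep_single_apply (g : Γ) (f : C₀(Ω, B)) (w z : Γ) :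
    (shift g * rep β ι f).1 (single w) z = if z = g * w then β w⁻¹ (f (ι.emb w)) else 0 := by
  change β (g⁻¹ * z)⁻¹ (f (ι.emb (g⁻¹ * z))) * (single w : L2 Γ B) (g⁻¹ * z) = _
  rw [single_apply]
  by_cases h : z = g * w
  · subst h
    simp
  · rw [if_neg h, if_neg fun h' => h (by rw [← h', mul_inv_cancel_left]), mul_zero]

variable (β ι) in
/-- `f` is the Fourier coefficient of `T` at `g`, that is, `T = ∑_g S_g f` formally. -/
def IsCoeff (T : EndB Γ B) (g : Γ) (f : C₀(Ω, B)) : Prop :=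
  ∀ y, T.1 (single y) (g * y) = β y⁻¹ (f (ι.emb y))

theorem IsCoeff.sub {T T' : EndB Γ B} {g : Γ} {f f' : C₀(Ω, B)} (h : IsCoeff β ι T g f)
    (h' : IsCoeff β ι T' g f') : IsCoeff β ι (T - T') g (f - f') := fun y => by
  change T.1 (single y) (g * y) - T'.1 (single y) (g * y) = β y⁻¹ (f (ι.emb y) - f' (ι.emb y))
  rw [h, h', map_sub]

theorem IsCoeff.norm_le {T : EndB Γ B} {g : Γ} {f : C₀(Ω, B)} (h : IsCoeff β ι T g f) :
    ‖f‖ ≤ ‖T‖ := by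
  refine norm_le_of_forall_apply (norm_nonneg T) fun ω => ?_
  refine ι.denseRange.induction_on ω (isClosed_le f.continuous.norm continuous_const) fun y => ?_
  rw [← norm_action (β := β) y⁻¹, ← h y]
  exact norm_endB_single_apply_le T _ _

theorem IsCoeff.unique {T : EndB Γ B} {g : Γ} {f f' : C₀(Ω, B)} (h : IsCoeff β ι T g f)
    (h' : IsCoeff β ι T g f') : f = f' := by
  have h1 := (h.sub h').norm_le
  rw [sub_self, norm_zero] at h1
  exact sub_eq_zero.1 (norm_le_zero_iff.1 h1)

/-- Elements of the crossed product by the ideal of functions vanishing on `Y` have Fourier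
coefficients vanishing on `Y`. -/
theorem exists_isCoeff {Y : Set Ω} {T : EndB Γ B}
    (hT : T ∈ crossedProduct β ι (vanishingOn B Y)) (g : Γ) :
    ∃ f ∈ vanishingOn B Y, IsCoeff β ι T g f := by
  classical
  have hspan : ∀ T ∈ crossedSpan β ι (vanishingOn B Y),
      ∃ f ∈ vanishingOn B Y, IsCoeff β ι T g f := fun T hT => by
    induction hT using Submodule.span_induction with
    | mem T h =>
      obtain ⟨h, f, hf, rfl⟩ := h
      by_cases hg : g = h
      · subst hg
        exact ⟨f, hf, fun y => by rw [shift_mul_rep_single_apply, if_pos rfl]⟩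
      · refine ⟨0, fun _ _ => rfl, fun y => ?_⟩
        rw [shift_mul_rep_single_apply, if_neg fun h' => hg (mul_right_cancel h')]
        exact (map_zero (β y⁻¹)).symm
    | zero => exact ⟨0, fun _ _ => rfl, fun y => (map_zero (β y⁻¹)).symm⟩
    | add K L _ _ hK hL =>
      obtain ⟨f, hf, h1⟩ := hK
      obtain ⟨k, hk, h2⟩ := hL
      refine ⟨f + k, fun ω hω => ?_, fun y => ?_⟩
      · rw [ZeroAtInftyContinuousMap.add_apply, hf ω hω, hk ω hω, add_zero]
      · change K.1 (single y) (g * y) + L.1 (single y) (g * y) =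
          β y⁻¹ (f (ι.emb y) + k (ι.emb y))
        rw [h1, h2, map_add]
    | smul c K _ hK =>
      obtain ⟨f, hf, h1⟩ := hK
      refine ⟨c • f, fun ω hω => ?_, fun y => ?_⟩
      · rw [ZeroAtInftyContinuousMap.smul_apply, hf ω hω, smul_zero]
      · change c • K.1 (single y) (g * y) = β y⁻¹ (c • f (ι.emb y))
        rw [h1, map_smul]
  obtain ⟨u, hu, hlim⟩ := mem_closure_iff_seq_limit.1 hT
  choose f hf hfu using fun n => hspan (u n) (hu n)
  have hcau : CauchySeq f := by
    have h1 := Metric.cauchySeq_iff.1 hlim.cauchySeq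
    refine Metric.cauchySeq_iff.2 fun ε hε => ?_
    obtain ⟨N, hN⟩ := h1 ε hε
    refine ⟨N, fun m hm n hn => ?_⟩
    have h2 := hN m hm n hn
    rw [dist_eq_norm] at h2 ⊢
    exact ((hfu m).sub (hfu n)).norm_le.trans_lt h2
  obtain ⟨f₀, hf₀⟩ := cauchySeq_tendsto_of_complete hcau
  have hpt : ∀ ω, Tendsto (fun n => f n ω) atTop (𝓝 (f₀ ω)) := fun ω =>
    (ZeroAtInftyContinuousMap.tendsto_iff_tendstoUniformly.1 hf₀).tendsto_at ω
  refine ⟨f₀, fun ω hω => ?_, fun y => ?_⟩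
  · refine tendsto_nhds_unique (hpt ω) ?_
    simp only [hf _ ω hω]
    exact tendsto_const_nhds
  · have h1 : Tendsto (fun n => (u n).1 (single y) (g * y)) atTop
        (𝓝 (T.1 (single y) (g * y))) := by
      rw [tendsto_iff_norm_sub_tendsto_zero] at hlim ⊢
      exact squeeze_zero (fun _ => norm_nonneg _)
        (fun n => norm_endB_single_apply_le (u n - T) (g * y) y) hlim
    refine tendsto_nhds_unique h1 ?_
    simp only [hfu _ y]
    have h2 : Continuous (β y⁻¹) :=
      AddMonoidHomClass.continuous_of_bound (β y⁻¹) 1 fun b => by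
        rw [one_mul]; exact norm_action_le β y⁻¹ b
    exact (h2.tendsto _).comp (hpt _)

theorem vanishingOn_empty : vanishingOn B (∅ : Set Ω) = univ :=
  eq_univ_of_forall fun _ _ h => h.elim

end Group

variable {Γ B Ω : Type*} [CommGroup Γ] [CStarAlgebra B] [TopologicalSpace Ω] [MulAction Γ Ω]
  {β : Γ →* (B →⋆ₐ[ℂ] B)} {ι : PartialCompactification Γ Ω}

theorem exists_multiple_near {T : EndB Γ B} {I : Set C₀(Ω, B)} (hT : T ∈ crossedSpan β ι I) :
    ∃ (S : Finset Γ) (C : ℝ), 0 ≤ C ∧ ∀ (E : Finset Γ) (η : ℝ),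
      (∀ g ∈ S, 1 - η ≤ overlap E g) → ∃ R, IsMultiple E T R ∧ ‖T - R‖ ≤ C * η := by
  classical
  induction hT using Submodule.span_induction with
  | mem T h =>
    obtain ⟨g, f, hf, rfl⟩ := h
    refine ⟨{g}, ‖shift g * rep β ι f‖, norm_nonneg _, fun E η hE =>
      ⟨(overlap E g : ℂ) • (shift g * rep β ι f), fun z w => ?_, ?_⟩⟩
    · change (overlap E g : ℂ) • (shift g * rep β ι f).1 (single w) z = _
      rw [shift_mul_rep_single_apply]
      split_ifs with h
      · rw [h, mul_inv_cancel_right]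
      · rw [smul_zero, smul_zero]
    · have h1 := hE g (Finset.mem_singleton_self g)
      have h2 := overlap_le_one E g
      have h3 : shift g * rep β ι f - (overlap E g : ℂ) • (shift g * rep β ι f) =
          ((1 - overlap E g : ℝ) : ℂ) • (shift g * rep β ι f) := by
        rw [Complex.ofReal_sub, sub_smul, Complex.ofReal_one, one_smul]
      rw [h3, norm_smul, Complex.norm_real, Real.norm_of_nonneg (by linarith), mul_comm]
      exact mul_le_mul_of_nonneg_left (by linarith) (norm_nonneg _)
  | zero =>
    refine ⟨∅, 0, le_rfl, fun E η _ => ⟨0, fun z w => ?_, by simp⟩⟩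
    exact (smul_zero _).symm
  | add K L _ _ hK hL =>
    obtain ⟨S, C, hC, h⟩ := hK
    obtain ⟨S', C', hC', h'⟩ := hL
    refine ⟨S ∪ S', C + C', add_nonneg hC hC', fun E η hE => ?_⟩
    obtain ⟨R, hR, hd⟩ := h E η fun g hg => hE g (Finset.mem_union_left _ hg)
    obtain ⟨R', hR', hd'⟩ := h' E η fun g hg => hE g (Finset.mem_union_right _ hg)
    refine ⟨R + R', fun z w => ?_, ?_⟩
    · change R.1 (single w) z + R'.1 (single w) z = _ • (K.1 (single w) z + L.1 (single w) z)
      rw [hR, hR', smul_add]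
    · rw [add_sub_add_comm, add_mul]
      exact (norm_add_le _ _).trans (add_le_add hd hd')
  | smul c K _ hK =>
    obtain ⟨S, C, hC, h⟩ := hK
    refine ⟨S, ‖c‖ * C, by positivity, fun E η hE => ?_⟩
    obtain ⟨R, hR, hd⟩ := h E η hE
    refine ⟨c • R, fun z w => ?_, ?_⟩
    · change c • R.1 (single w) z = _ • c • K.1 (single w) z
      rw [hR, smul_comm]
    · rw [← smul_sub, norm_smul, mul_assoc]
      gcongr

theorem exists_multiple_mem {Y : Set Ω} {T : EndB Γ B}
    (h : ∀ g, ∃ f ∈ vanishingOn B Y, IsCoeff β ι T g f) (E : Finset Γ) :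
    ∃ R ∈ crossedSpan β ι (vanishingOn B Y), IsMultiple E T R := by
  classical
  choose f hf hT using h
  refine ⟨∑ g ∈ Finset.image₂ (fun x y => x * y⁻¹) E E,
    (overlap E g : ℂ) • (shift g * rep β ι (f g)),
    sum_mem fun g _ => Submodule.smul_mem _ _ (Submodule.subset_span ⟨g, f g, hf g, rfl⟩),
    fun z w => ?_⟩
  have h1 : (∑ g ∈ Finset.image₂ (fun x y => x * y⁻¹) E E,
      (overlap E g : ℂ) • (shift g * rep β ι (f g)) : EndB Γ B).1 (single w) z =
      ∑ g ∈ Finset.image₂ (fun x y => x * y⁻¹) E E,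
        (overlap E g : ℂ) • (shift g * rep β ι (f g)).1 (single w) z := by
    rw [AddSubmonoidClass.coe_finsetSum, _root_.sum_apply, L2.sum_apply]
    rfl
  rw [h1, Finset.sum_eq_single (z * w⁻¹)]
  · rw [shift_mul_rep_single_apply, if_pos (by rw [inv_mul_cancel_right]), ← hT (z * w⁻¹),
      inv_mul_cancel_right]
  · intro g _ hg
    rw [shift_mul_rep_single_apply, if_neg fun h => hg (by rw [h, mul_inv_cancel_right]),
      smul_zero]
  · intro hz
    have h2 : overlap E (z * w⁻¹) = 0 := by
      unfold overlap
      rw [Finset.filter_false_of_mem, Finset.card_empty, Nat.cast_zero, zero_div]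
      intro e he he'
      refine hz (Finset.mem_image₂.2 ⟨_, he', e, he, ?_⟩)
      rw [mul_inv_cancel_right]
    rw [h2, Complex.ofReal_zero, zero_smul]

/-- An element of the crossed product whose Fourier coefficients vanish on `Y` belongs to the
crossed product by the ideal of functions vanishing on `Y`. -/
theorem mem_crossedProduct_of_coeff {Y : Set Ω} {T : EndB Γ B}
    (hT : T ∈ crossedProduct β ι univ) (h : ∀ g f, IsCoeff β ι T g f → f ∈ vanishingOn B Y) :
    T ∈ crossedProduct β ι (vanishingOn B Y) := by
  have hc : ∀ g, ∃ f ∈ vanishingOn B Y, IsCoeff β ι T g f := fun g => by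
    rw [← vanishingOn_empty] at hT
    obtain ⟨f, -, hf⟩ := exists_isCoeff hT g
    exact ⟨f, h g f hf, hf⟩
  rw [← SetLike.mem_coe, ← (isClosed_crossedProduct _).closure_eq]
  refine Metric.mem_closure_iff.2 fun ε hε => ?_
  obtain ⟨T', hT', hd⟩ := Metric.mem_closure_iff.1 hT (ε / 4) (by positivity)
  obtain ⟨S, C, hC, hS⟩ := exists_multiple_near (ι := ι) hT'
  obtain ⟨E, hE, hov⟩ := exists_one_sub_le_overlap S
    (show 0 < ε / (4 * (C + 1)) by positivity)
  obtain ⟨R', hR', hd'⟩ := hS E _ hov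
  obtain ⟨R, hR, hRm⟩ := exists_multiple_mem hc E
  refine ⟨R, crossedSpan_le_crossedProduct _ hR, ?_⟩
  have h1 := norm_multiple_le hE (hR'.sub hRm)
  rw [dist_eq_norm] at hd ⊢
  rw [norm_sub_rev T' T] at h1
  have h2 : C * (ε / (4 * (C + 1))) ≤ ε / 4 := by
    rw [mul_div_assoc', div_le_div_iff₀ (by positivity) (by positivity)]
    nlinarith
  calc ‖T - R‖ = ‖(T - T') + (T' - R') + (R' - R)‖ := by congr 1; abel
    _ ≤ ‖T - T'‖ + ‖T' - R'‖ + ‖R' - R‖ := norm_add₃_le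
    _ < ε := by linarith

end Fourier

/-! ### Spectral bumps at zero -/

section Bump

/-- A bump function at zero, of width of order `1 / (n + 1)`. -/
def bump (n : ℕ) (t : ℝ) : ℝ := max 0 (min 1 (2 - (n + 1) * |t|))

theorem continuous_bump (n : ℕ) : Continuous (bump n) := by
  unfold bump
  fun_prop

theorem bump_nonneg (n : ℕ) (t : ℝ) : 0 ≤ bump n t := le_max_left _ _

theorem bump_le_one (n : ℕ) (t : ℝ) : bump n t ≤ 1 := max_le zero_le_one (min_le_left _ _)

theorem bump_eq_one {n : ℕ} {t : ℝ} (h : (n + 1) * |t| ≤ 1) : bump n t = 1 := by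
  unfold bump
  rw [min_eq_left (by linarith), max_eq_right zero_le_one]

theorem bump_eq_zero {n : ℕ} {t : ℝ} (h : 2 ≤ (n + 1) * |t|) : bump n t = 0 := by
  unfold bump
  exact max_eq_left ((min_le_right _ _).trans (by linarith))

theorem bump_mul_bump (n : ℕ) (t : ℝ) : bump n t * bump (2 * n + 1) t = bump (2 * n + 1) t := by
  rcases le_total ((n + 1 : ℝ) * |t|) 1 with h | h
  · rw [bump_eq_one h, one_mul]
  · rw [bump_eq_zero (n := 2 * n + 1) (by push_cast; linarith), mul_zero]

theorem norm_mul_bump_le (n : ℕ) (t : ℝ) : ‖t * bump n t‖ ≤ 2 / (n + 1) := by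
  rw [norm_mul, Real.norm_eq_abs, Real.norm_of_nonneg (bump_nonneg n t)]
  rcases le_total 2 ((n + 1 : ℝ) * |t|) with h | h
  · rw [bump_eq_zero h, mul_zero]
    positivity
  · rw [le_div_iff₀ (by positivity)]
    nlinarith [bump_le_one n t, bump_nonneg n t, abs_nonneg t,
      mul_le_mul_of_nonneg_left (bump_le_one n t) (abs_nonneg t), n.cast_nonneg (α := ℝ)]

theorem sq_add_bump_pos (n : ℕ) (t : ℝ) : 0 < t ^ 2 + bump n t := by
  by_cases ht : t = 0
  · rw [ht, bump_eq_one (by simp)]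
    norm_num
  · have := bump_nonneg n t
    positivity

variable {E : Type*} [CStarAlgebra E] {T : E}

theorem cfc_bump_mul_cfc_bump (n : ℕ) :
    cfc (bump n) T * cfc (bump (2 * n + 1)) T = cfc (bump (2 * n + 1)) T := by
  rw [← cfc_mul _ _ T (continuous_bump _).continuousOn (continuous_bump _).continuousOn]
  simp only [bump_mul_bump]

theorem norm_mul_cfc_bump_le (hT : IsSelfAdjoint T) (n : ℕ) :
    ‖T * cfc (bump n) T‖ ≤ 2 / (n + 1) := by
  have h : T * cfc (bump n) T = cfc (fun t => t * bump n t) T := by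
    rw [cfc_mul _ _ T (continuousOn_id' _) (continuous_bump _).continuousOn, cfc_id' ℝ T hT]
  rw [h]
  exact norm_cfc_le (by positivity) fun t _ => norm_mul_bump_le n t

theorem exists_mul_sq_add_mul_cfc_bump_eq_one {V : StarSubalgebra ℂ E}
    (hV : IsClosed (V : Set E)) (hTV : T ∈ V) (hT : IsSelfAdjoint T) (n : ℕ) :
    ∃ r ∈ V, r * T * T + r * cfc (bump n) T = 1 := by
  have : IsClosed (V : Set E) := hV
  refine ⟨cfc (fun t : ℝ => (t ^ 2 + bump n t)⁻¹) T, cfc_mem _ hTV, ?_⟩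
  have h1 : Continuous fun t : ℝ => t ^ 2 + bump n t := (continuous_pow 2).add (continuous_bump n)
  have h2 : Continuous fun t : ℝ => (t ^ 2 + bump n t)⁻¹ :=
    h1.inv₀ fun t => (sq_add_bump_pos n t).ne'
  have h3 : T * T + cfc (bump n) T = cfc (fun t : ℝ => t ^ 2 + bump n t) T := by
    rw [cfc_add T _ _ (continuous_pow 2).continuousOn (continuous_bump n).continuousOn,
      cfc_pow_id T 2, sq]
  rw [mul_assoc, ← mul_add, h3, ← cfc_mul _ _ T h2.continuousOn h1.continuousOn]
  have h4 : (fun t : ℝ => (t ^ 2 + bump n t)⁻¹ * (t ^ 2 + bump n t)) = fun _ => 1 :=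
    funext fun t => inv_mul_cancel₀ (sq_add_bump_pos n t).ne'
  rw [h4, cfc_const_one ℝ T]

end Bump

/-! ### One-sided invertibility modulo ideals of functions vanishing on invariant sets -/

section LeftInvertible

variable {Γ B Ω : Type*} [Group Γ] [CStarAlgebra B] [TopologicalSpace Ω] [MulAction Γ Ω]
  {β : Γ →* (B →⋆ₐ[ℂ] B)} {ι : PartialCompactification Γ Ω}

theorem isClosed_boundary : IsClosed ι.boundary := by
  rw [PartialCompactification.boundary, isClosed_compl_iff, ← iUnion_singleton_eq_range]
  exact isOpen_iUnion ι.isOpen_singleton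

theorem smul_mem_boundary (g : Γ) {ω : Ω} (h : ω ∈ ι.boundary) : g • ω ∈ ι.boundary := by
  rintro ⟨x, hx⟩
  exact h ⟨g⁻¹ * x, by rw [ι.emb_mul, hx, inv_smul_smul]⟩

variable [ContinuousConstSMul Γ Ω]

variable (β ι) in
/-- `T` has a left inverse modulo the crossed product by the functions vanishing on `Y`. -/
def LeftInvertibleMod (Y : Set Ω) (T : EndB Γ B) : Prop :=
  ∃ G ∈ unitizedClosure β ι, G * T - 1 ∈ crossedProduct β ι (vanishingOn B Y)

theorem LeftInvertibleMod.mono {Y Z : Set Ω} (h : Y ⊆ Z) {T : EndB Γ B}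
    (hT : LeftInvertibleMod β ι Z T) : LeftInvertibleMod β ι Y T := by
  obtain ⟨G, hG, h1⟩ := hT
  exact ⟨G, hG, crossedProduct_mono (vanishingOn_anti h) h1⟩

theorem LeftInvertibleMod.union {Y Z : Set Ω} (hY : ∀ (g : Γ), ∀ y ∈ Y, g • y ∈ Y) {T : EndB Γ B}
    (hTV : T ∈ unitizedClosure β ι) (h : LeftInvertibleMod β ι Y T)
    (h' : LeftInvertibleMod β ι Z T) : LeftInvertibleMod β ι (Y ∪ Z) T := by
  obtain ⟨G, hG, h1⟩ := h
  obtain ⟨K, hK, h2⟩ := h'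
  refine ⟨G + K - G * T * K, sub_mem (add_mem hG hK) (mul_mem (mul_mem hG hTV) hK), ?_⟩
  have h3 := neg_mem (mul_mem_crossedProduct_union hY h1 h2)
  convert h3 using 1
  noncomm_ring

theorem LeftInvertibleMod.exists_of_sInter {S : Set (Set Ω)} (hne : S.Nonempty)
    (hS : IsChain (· ⊆ ·) S) (hc : ∀ Z ∈ S, IsClosed Z)
    (hinv : ∀ Z ∈ S, ∀ (g : Γ), ∀ z ∈ Z, g • z ∈ Z) {T : EndB Γ B}
    (hTV : T ∈ unitizedClosure β ι) (h : LeftInvertibleMod β ι (⋂₀ S) T) :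
    ∃ Z ∈ S, LeftInvertibleMod β ι Z T := by
  obtain ⟨G, hG, h1⟩ := h
  obtain ⟨Z, hZ, K, hK, hd⟩ := exists_near_mem_of_chain hne hS hc h1 one_pos
  have hKV := crossedProduct_subset_closure hK
  obtain ⟨r, hr, h2⟩ := exists_left_inverse_one_sub isClosed_unitizedClosure
    (t := -(G * T - 1 - K))
    (neg_mem (sub_mem (sub_mem (mul_mem hG hTV) (one_mem _)) hKV)) (by rwa [norm_neg])
  refine ⟨Z, hZ, r * G, mul_mem hr hG, ?_⟩
  have h3 := mul_mem_crossedProduct_of_closure (isInvariantIdeal_vanishingOn (hinv Z hZ)) hr hK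
  convert h3 using 1
  rw [← h2]
  noncomm_ring

/-- If `T` is invertible modulo the ideal of `Y`, then small spectral bumps of `T` lie in it. -/
theorem LeftInvertibleMod.exists_cfc_bump_mem {Y : Set Ω} (hY : ∀ (g : Γ), ∀ y ∈ Y, g • y ∈ Y)
    {T : EndB Γ B} (hT : IsSelfAdjoint T) (hTV : T ∈ unitizedClosure β ι)
    (h : LeftInvertibleMod β ι Y T) :
    ∃ n, cfc (bump n) T ∈ crossedProduct β ι (vanishingOn B Y) := by
  obtain ⟨G, hG, h1⟩ := h
  have hcl : IsClosed (unitizedClosure β ι : Set (EndB Γ B)) := isClosed_unitizedClosure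
  obtain ⟨m, hm⟩ := exists_nat_gt (2 * ‖G‖)
  have hbV : ∀ n, cfc (bump n) T ∈ unitizedClosure β ι := fun n => cfc_mem _ hTV
  have hnorm : ‖G * T * cfc (bump m) T‖ < 1 := by
    rw [mul_assoc]
    calc _ ≤ ‖G‖ * ‖T * cfc (bump m) T‖ := norm_mul_le _ _
      _ ≤ ‖G‖ * (2 / (m + 1)) := by gcongr; exact norm_mul_cfc_bump_le hT m
      _ < 1 := by rw [mul_div_assoc', div_lt_one (by positivity)]; linarith
  obtain ⟨r, hr, h2⟩ := exists_left_inverse_one_sub hcl (mul_mem (mul_mem hG hTV) (hbV m)) hnorm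
  have hI : IsInvariantIdeal β (vanishingOn B Y) := isInvariantIdeal_vanishingOn hY
  refine ⟨2 * m + 1, ?_⟩
  have h3 := neg_mem (mul_mem_crossedProduct_of_closure hI hr
    (crossedProduct_mul_mem_of_closure hI (hbV (2 * m + 1)) h1))
  convert h3 using 1
  calc cfc (bump (2 * m + 1)) T
      = r * (1 - G * T * cfc (bump m) T) * cfc (bump (2 * m + 1)) T := by rw [h2, one_mul]
    _ = r * (cfc (bump (2 * m + 1)) T -
        G * T * (cfc (bump m) T * cfc (bump (2 * m + 1)) T)) := by noncomm_ring
    _ = r * (cfc (bump (2 * m + 1)) T - G * T * cfc (bump (2 * m + 1)) T) := by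
        rw [cfc_bump_mul_cfc_bump]
    _ = _ := by noncomm_ring

theorem leftInvertibleMod_of_cfc_bump_mem {Y : Set Ω} (hY : ∀ (g : Γ), ∀ y ∈ Y, g • y ∈ Y)
    {T : EndB Γ B} (hT : IsSelfAdjoint T) (hTV : T ∈ unitizedClosure β ι) {n : ℕ}
    (h : cfc (bump n) T ∈ crossedProduct β ι (vanishingOn B Y)) : LeftInvertibleMod β ι Y T := by
  obtain ⟨r, hr, h1⟩ :=
    exists_mul_sq_add_mul_cfc_bump_eq_one isClosed_unitizedClosure hTV hT n
  refine ⟨r * T, mul_mem hr hTV, ?_⟩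
  have h2 := neg_mem (mul_mem_crossedProduct_of_closure (isInvariantIdeal_vanishingOn hY) hr h)
  convert h2 using 1
  rw [← h1]
  abel

end LeftInvertible

section Exhaustion

variable {Γ B Ω : Type*} [CommGroup Γ] [CStarAlgebra B] [TopologicalSpace Ω] [MulAction Γ Ω]
  {β : Γ →* (B →⋆ₐ[ℂ] B)} {ι : PartialCompactification Γ Ω}

theorem mem_crossedProduct_closure_of_quasiOrbits {D : Set Ω} (hD : D.Nonempty) {T : EndB Γ B}
    (h : ∀ ω ∈ D, T ∈ crossedProduct β ι (vanishingOn B (quasiOrbit Γ ω))) :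
    T ∈ crossedProduct β ι (vanishingOn B (closure D)) := by
  obtain ⟨ω₀, hω₀⟩ := hD
  refine mem_crossedProduct_of_coeff (crossedProduct_mono (subset_univ _) (h ω₀ hω₀))
    fun g f hf ω hω => ?_
  refine closure_minimal (t := {ω | f ω = 0}) (fun ω hω => ?_)
    (isClosed_eq f.continuous continuous_const) hω
  obtain ⟨f', hf', hc⟩ := exists_isCoeff (h ω hω) g
  rw [mem_ofPred_eq, hf.unique hc]
  exact hf' ω (mem_quasiOrbit_self ω)

variable [ContinuousConstSMul Γ Ω]

/-- A self-adjoint element which is invertible on every quasi-orbit of the boundary is invertible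
on the boundary. -/
theorem leftInvertibleMod_boundary [T2Space Ω] [LocallyCompactSpace Ω]
    (hne : ι.boundary.Nonempty) {T : EndB Γ B} (hT : IsSelfAdjoint T)
    (hTV : T ∈ unitizedClosure β ι)
    (h : ∀ ω ∈ ι.boundary, LeftInvertibleMod β ι (quasiOrbit Γ ω) T) :
    LeftInvertibleMod β ι ι.boundary T := by
  by_contra hcon
  let S : Set (Set Ω) := {Z | IsClosed Z ∧ (∀ (g : Γ), ∀ z ∈ Z, g • z ∈ Z) ∧
    ¬ LeftInvertibleMod β ι Z T}
  obtain ⟨Z, hZb, ⟨hZc, hZi, hZn⟩, hmin⟩ := zorn_superset_nonempty S (fun c hc hchain hcne =>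
    ⟨⋂₀ c, ⟨isClosed_sInter fun Y hY => (hc hY).1,
      fun g z hz Y hY => (hc hY).2.1 g z (hz Y hY), fun hl => by
        obtain ⟨Y, hY, hl'⟩ := hl.exists_of_sInter hcne hchain (fun Y hY => (hc hY).1)
          (fun Y hY => (hc hY).2.1) hTV
        exact (hc hY).2.2 hl'⟩, fun Y hY => sInter_subset_of_mem hY⟩)
    ι.boundary ⟨isClosed_boundary, fun g _ hz => smul_mem_boundary g hz, hcon⟩
  have hZne : Z.Nonempty := by
    rw [nonempty_iff_ne_empty]
    rintro rfl
    obtain ⟨ω, hω⟩ := hne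
    exact hZn ((h ω hω).mono (empty_subset _))
  let D : ℕ → Set Ω := fun n =>
    {ω | ω ∈ Z ∧ cfc (bump n) T ∈ crossedProduct β ι (vanishingOn B (quasiOrbit Γ ω))}
  have hDi : ∀ n (g : Γ), ∀ ω ∈ D n, g • ω ∈ D n := fun n g ω hω =>
    ⟨hZi g ω hω.1, crossedProduct_mono (vanishingOn_anti
      (quasiOrbit_subset (fun _ _ => smul_mem_quasiOrbit _) isClosed_closure
        (smul_mem_quasiOrbit g (mem_quasiOrbit_self ω)))) hω.2⟩
  have hDci : ∀ n (g : Γ), ∀ ω ∈ closure (D n), g • ω ∈ closure (D n) := fun n g ω hω =>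
    map_mem_closure (continuous_const_smul g) hω (hDi n g)
  have : Nonempty Z := hZne.to_subtype
  have : LocallyCompactSpace Z := hZc.isClosedEmbedding_subtypeVal.locallyCompactSpace
  obtain ⟨n, z, hz⟩ := nonempty_interior_of_iUnion_of_closed
    (f := fun n => ((↑) : Z → Ω) ⁻¹' closure (D n))
    (fun n => isClosed_closure.preimage continuous_subtype_val)
    (eq_univ_of_forall fun z => by
      obtain ⟨n, hn⟩ := (h z (hZb z.2)).exists_cfc_bump_mem
        (fun _ _ => smul_mem_quasiOrbit _) hT hTV
      exact mem_iUnion.2 ⟨n, subset_closure ⟨z.2, hn⟩⟩)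
  obtain ⟨W, hW, hWo, hzW⟩ := mem_interior.1 hz
  obtain ⟨O, hO, rfl⟩ := isOpen_induced_iff.1 hWo
  have hDne : (D n).Nonempty := closure_nonempty_iff.1 ⟨z, hW hzW⟩
  have hl1 : LeftInvertibleMod β ι (closure (D n)) T :=
    leftInvertibleMod_of_cfc_bump_mem (hDci n) hT hTV
      (mem_crossedProduct_closure_of_quasiOrbits hDne fun ω hω => hω.2)
  let Y : Set Ω := Z ∩ ⋂ g : Γ, (fun ω => g • ω) ⁻¹' Oᶜ
  have hYi : ∀ (g : Γ), ∀ y ∈ Y, g • y ∈ Y := fun g y hy =>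
    ⟨hZi g y hy.1, mem_iInter.2 fun k => by
      have := mem_iInter.1 hy.2 (k * g)
      rwa [mem_preimage, mul_smul] at this⟩
  have hYc : IsClosed Y := hZc.inter (isClosed_iInter fun g =>
    hO.isClosed_compl.preimage (continuous_const_smul g))
  have hl2 : LeftInvertibleMod β ι Y T := by
    by_contra hY
    have h1 := hmin ⟨hYc, hYi, hY⟩ inter_subset_left z.2
    have h2 := mem_iInter.1 h1.2 1
    rw [mem_preimage, one_smul] at h2
    exact h2 hzW
  refine hZn ((hl2.union hYi hTV hl1).mono fun ω hω => ?_)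
  by_cases hY : ω ∈ Y
  · exact Or.inl hY
  · right
    obtain ⟨g, hg⟩ : ∃ g : Γ, g • ω ∈ O := by
      by_contra! hno
      exact hY ⟨hω, mem_iInter.2 hno⟩
    have h1 : g • ω ∈ closure (D n) := hW (show (⟨g • ω, hZi g ω hω⟩ : Z).1 ∈ O from hg)
    simpa using hDci n g⁻¹ _ h1

end Exhaustion

section Fredholm

theorem isUnit_mk_of_inverses_mod {R : Type*} [Ring R] {I : Ideal R} [I.IsTwoSided] {F G K : R}
    (hG : G * F - 1 ∈ I) (hK : F * K - 1 ∈ I) : IsUnit (Ideal.Quotient.mk I F) := by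
  have hl := Ideal.Quotient.eq.2 hG
  have hr := Ideal.Quotient.eq.2 hK
  rw [map_mul, map_one] at hl hr
  have heq := left_inv_eq_right_inv hl hr
  exact ⟨⟨_, _, hr, heq ▸ hl⟩, rfl⟩

theorem isFredholm_of_finite {Γ B : Type*} [CStarAlgebra B] [Finite Γ] (F : EndB Γ B) : IsFredholm F := by
  have h : compactOperators Γ B = ⊤ := (Ideal.eq_top_iff_one _).2 one_mem_compactOperators
  have : Subsingleton (EndB Γ B ⧸ compactOperators Γ B) := Ideal.Quotient.subsingleton_iff.2 h
  exact isUnit_of_subsingleton _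


variable {Γ B Ω : Type*} [Group Γ] [CStarAlgebra B] [TopologicalSpace Ω] [MulAction Γ Ω]
  [ContinuousConstSMul Γ Ω] {β : Γ →* (B →⋆ₐ[ℂ] B)} {ι : PartialCompactification Γ Ω}

theorem exists_inverse_mod_of_isUnit_bulkMap {ω : Ω} {F : unitizedCrossedProduct β ι}
    (h : IsUnit (bulkMap β ι ω F)) : ∃ G ∈ unitizedClosure β ι,
      G * F.1 - 1 ∈ crossedProduct β ι (vanishingOn B (quasiOrbit Γ ω)) ∧
      F.1 * G - 1 ∈ crossedProduct β ι (vanishingOn B (quasiOrbit Γ ω)) := by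
  obtain ⟨u, hu⟩ := h
  obtain ⟨G, hG⟩ := Ideal.Quotient.mk_surjective (I := bulkIdeal β ι ω) (u⁻¹ : _).1
  refine ⟨G.1, unitizedCrossedProduct_subset_closure G.2, ?_, ?_⟩
  · have h1 : Ideal.Quotient.mk (bulkIdeal β ι ω) (G * F) =
        Ideal.Quotient.mk (bulkIdeal β ι ω) 1 := by
      rw [map_mul, map_one, hG]
      change _ * bulkMap β ι ω F = 1
      rw [← hu]
      exact u.inv_mul
    exact Ideal.Quotient.eq.1 h1
  · have h1 : Ideal.Quotient.mk (bulkIdeal β ι ω) (F * G) =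
        Ideal.Quotient.mk (bulkIdeal β ι ω) 1 := by
      rw [map_mul, map_one, hG]
      change bulkMap β ι ω F * _ = 1
      rw [← hu]
      exact u.mul_inv
    exact Ideal.Quotient.eq.1 h1

theorem leftInvertibleMod_star_mul_self {Y : Set Ω} (hY : ∀ (g : Γ), ∀ y ∈ Y, g • y ∈ Y)
    {F G : EndB Γ B} (hF : F ∈ unitizedClosure β ι) (hG : G ∈ unitizedClosure β ι)
    (h1 : G * F - 1 ∈ crossedProduct β ι (vanishingOn B Y))
    (h2 : F * G - 1 ∈ crossedProduct β ι (vanishingOn B Y)) :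
    LeftInvertibleMod β ι Y (star F * F) := by
  have hI : IsInvariantIdeal β (vanishingOn B Y) := isInvariantIdeal_vanishingOn hY
  refine ⟨G * star G, mul_mem hG (star_mem hG), ?_⟩
  have h3 := star_mem_crossedProduct hI (fun _ => star_mem_vanishingOn) h2
  have h4 := add_mem (mul_mem_crossedProduct_of_closure hI hG
    (crossedProduct_mul_mem_of_closure hI hF h3)) h1
  convert h4 using 1
  rw [star_sub, star_mul, star_one]
  noncomm_ring

theorem isFredholm_of_leftInvertibleMod_boundary {F : EndB Γ B}
    (h1 : LeftInvertibleMod β ι ι.boundary (star F * F))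
    (h2 : LeftInvertibleMod β ι ι.boundary (F * star F)) : IsFredholm F := by
  obtain ⟨G, -, hG⟩ := h1
  obtain ⟨K, -, hK⟩ := h2
  have hI : IsInvariantIdeal β (vanishingOn B ι.boundary) :=
    isInvariantIdeal_vanishingOn fun g _ hz => smul_mem_boundary g hz
  have hK' := star_mem_crossedProduct hI (fun _ => star_mem_vanishingOn) hK
  rw [star_sub, star_mul, star_mul, star_star, star_one] at hK'
  have hl := crossedProduct_boundary_le hG
  have hr := crossedProduct_boundary_le hK'
  rw [← mul_assoc] at hl
  rw [mul_assoc] at hr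
  exact isUnit_mk_of_inverses_mod hl hr

end Fredholm

end CStarInterface

end

theorem mainTheorem7
    {Γ B Ω J : Type*} [CommGroup Γ] [Countable Γ]
    [CStarAlgebra B] [TopologicalSpace.SeparableSpace B] (β : Γ →* (B →⋆ₐ[ℂ] B))
    [TopologicalSpace Ω] [T2Space Ω] [LocallyCompactSpace Ω] [MulAction Γ Ω]
    [ContinuousConstSMul Γ Ω] (ι : CStarInterface.PartialCompactification Γ Ω)
    (ω : J → Ω) (hcover : ι.boundary = ⋃ j, CStarInterface.quasiOrbit Γ (ω j))
    (hne : Infinite Γ → ι.boundary.Nonempty)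
    (F : CStarInterface.unitizedCrossedProduct β ι) (ε : ℝ) (hε : 0 < ε)
    (hgap : ∀ j, ∀ t : ℝ, t ∈ Set.Ioo (-ε) ε →
      (t : ℂ) ∉ spectrum ℂ (CStarInterface.bulkMap β ι (ω j) F)) :
    CStarInterface.IsFredholm (F : CStarInterface.EndB Γ B) := by
  open CStarInterface in
  rcases finite_or_infinite Γ with hfin | hinf
  · exact isFredholm_of_finite _
  have hFV : F.1 ∈ unitizedClosure β ι := unitizedCrossedProduct_subset_closure F.2
  have hinv : ∀ η : Ω, ∀ (g : Γ), ∀ y ∈ quasiOrbit Γ η, g • y ∈ quasiOrbit Γ η :=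
    fun η g y hy => smul_mem_quasiOrbit g hy
  have hloc : ∀ η ∈ ι.boundary,
      LeftInvertibleMod β ι (quasiOrbit Γ η) (star F.1 * F.1) ∧
      LeftInvertibleMod β ι (quasiOrbit Γ η) (F.1 * star F.1) := by
    intro η hη
    rw [hcover] at hη
    obtain ⟨j, hj⟩ := mem_iUnion.1 hη
    have hunit : IsUnit (bulkMap β ι (ω j) F) := by
      have h0 := hgap j 0 ⟨by linarith, hε⟩
      rw [Complex.ofReal_zero] at h0
      exact (spectrum.zero_notMem_iff ℂ).1 h0
    obtain ⟨G, hG, h1, h2⟩ := exists_inverse_mod_of_isUnit_bulkMap hunit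
    have hsub : quasiOrbit Γ η ⊆ quasiOrbit Γ (ω j) :=
      quasiOrbit_subset (hinv (ω j)) isClosed_closure hj
    have hI : IsInvariantIdeal β (vanishingOn B (quasiOrbit Γ (ω j))) :=
      isInvariantIdeal_vanishingOn (hinv (ω j))
    have h1' := star_mem_crossedProduct hI (fun _ => star_mem_vanishingOn) h1
    have h2' := star_mem_crossedProduct hI (fun _ => star_mem_vanishingOn) h2
    rw [star_sub, star_mul, star_one] at h1' h2'
    refine ⟨(leftInvertibleMod_star_mul_self (hinv _) hFV hG h1 h2).mono hsub, ?_⟩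
    have h3 := leftInvertibleMod_star_mul_self (hinv _) (star_mem hFV) (star_mem hG) h2' h1'
    rw [star_star] at h3
    exact h3.mono hsub
  exact isFredholm_of_leftInvertibleMod_boundary
    (leftInvertibleMod_boundary (hne hinf) (IsSelfAdjoint.star_mul_self F.1)
      (mul_mem (star_mem hFV) hFV) fun η hη => (hloc η hη).1)
    (leftInvertibleMod_boundary (hne hinf) (IsSelfAdjoint.mul_star_self F.1)
      (mul_mem hFV (star_mem hFV)) fun η hη => (hloc η hη).2)
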